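/- Let $\mathcal T$ be a Galton--Watson (branching process) tree with root $\varnothing$ and i.i.d. offspring numbers distributed as $X$, where $X\ge 1$ almost surely and $\mathbb P(X>x)=c\,x^{-\alpha}(1+o(1))$ as $x\to\infty$ for some $\alpha>0$, $c>0$. Independently of the tree, give the edges i.i.d. weights $w(e)$ that are uniform on $[0,1]$. Invasion percolation starts from $T_0=\{\varnothing\}$ and at each step adds the vertex outside the current subtree that is joined to it by the edge of smallest weight; let $T=\bigcup_n T_n$ be the invasion percolation cluster. Almost surely $T$ contains exactly one infinite path $(v_i)_{i\ge0}$ from $v_0=\varnothing$, called the backbone. Let $\beta_i$ be the weight of the edge $\{v_{i-1},v_i\}$, and let $W_k=\max_{i>k}\beta_i$ be the future maximum weight. Let $\mathcal M_k$ be the component of the root in $T$ after removing the edge $\{v_k,v_{k+1}\}$, let $C_k=\sum_{e\in E(\mathcal M_k)}w(e)$, and put $\mathcal M_{-1}=\emptyset$, $C_{-1}=0$, $\beta_0=0$. For $k\ge0$ let $\mathcal H_k=(\mathcal M_k\setminus\mathcal M_{k-1})\setminus\{v_k\}$ be the forest that hangs off the backbone vertex $v_k$; its edges are the edges that join its vertices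 to their parents. Let $H_k=|\mathcal H_k|$, which is the number of these edges, and let $B_k=C_k-C_{k-1}-\beta_k$, the cumulative weight attached to $v_k$. Then, for every $k\ge0$, the forest $\mathcal H_k$ is almost surely finite, and conditionally on $W_k=w_k$ and on the forest $\mathcal H_k$ (as a set of vertices of the tree, labelled by Ulam--Harris words), the weights of the $H_k$ edges of $\mathcal H_k$ are i.i.d. uniform on $[0,w_k]$. Consequently, conditionally on $W_k=w_k$, $$B_k \overset{d}{=} \sum_{i=1}^{H_k} U_i,$$ where, conditionally on $W_k=w_k$, the $U_i$ are i.i.d. uniform on $[0,w_k]$ and independent of $H_k$. -/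

import Mathlib

open MeasureTheory ProbabilityTheory Filter Topology

/-!
Vertices are Ulam-Harris words, written with the youngest letter first: `[]` is the root, the
children of `v` are the words `i :: v`, and the ancestors of `v` (with `v` itself) are its suffixes.
A realisation of the weighted tree consists of offspring numbers `x v` and of weights `w v`, where
`w v` is the weight of the edge between the vertex `v ≠ []` and its parent.
-/

namespace InvasionPercolation

/-- The vertex set of the tree in which `v` has the children `i :: v`, `i < x v`. -/
def treeVertices (x : List ℕ → ℕ) : Set (List ℕ) :=
  {v | ∀ (i : ℕ) (u : List ℕ), (i :: u) <:+ v → i < x u}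

/-- The vertices of the tree outside `S` whose parent lies in `S`. -/
def boundary (x : List ℕ → ℕ) (S : Set (List ℕ)) : Set (List ℕ) :=
  {v | v ∈ treeVertices x ∧ v ∉ S ∧ ∃ (i : ℕ) (u : List ℕ), u ∈ S ∧ v = i :: u}

/-- The cluster after `n` steps of invasion percolation: each step adds the boundary vertex of
minimal edge weight. (If several boundary vertices were minimal, all of them would be added; for
i.i.d. uniform weights such a tie has probability zero.) -/
def invaded (x : List ℕ → ℕ) (w : List ℕ → ℝ) : ℕ → Set (List ℕ)
  | 0 => {[]}
  | n + 1 => invaded x w n ∪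
      {v | v ∈ boundary x (invaded x w n) ∧ ∀ u ∈ boundary x (invaded x w n), w v ≤ w u}

/-- The invasion percolation cluster (IPC). -/
def cluster (x : List ℕ → ℕ) (w : List ℕ → ℝ) : Set (List ℕ) :=
  ⋃ n, invaded x w n

/-- `b` is a path from the root to infinity inside the IPC. -/
def IsBackbone (x : List ℕ → ℕ) (w : List ℕ → ℝ) (b : ℕ → List ℕ) : Prop :=
  b 0 = [] ∧ (∀ k, ∃ i : ℕ, b (k + 1) = i :: b k) ∧ ∀ k, b k ∈ cluster x w

/-- The path to infinity in the IPC (meaningful when there is exactly one). -/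
noncomputable def backbone (x : List ℕ → ℕ) (w : List ℕ → ℝ) : ℕ → List ℕ :=
  Classical.epsilon (IsBackbone x w)

/-- The future maximum weight: the largest weight on the backbone beyond its `k`-th vertex (a supremum
of a nonempty set of numbers in `[0, 1]`, which is the maximum whenever the maximum exists). -/
noncomputable def futureMax (x : List ℕ → ℕ) (w : List ℕ → ℝ) (k : ℕ) : ℝ :=
  sSup {β | ∃ i, k < i ∧ β = w (backbone x w i)}

/-- The vertices of the `k`-cut IPC: the component of the root after the edge between the `k`-th
and the `(k+1)`-st backbone vertex is cut. -/
def cut (x : List ℕ → ℕ) (w : List ℕ → ℝ) (k : ℕ) : Set (List ℕ) :=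
  {v | v ∈ cluster x w ∧ ¬ backbone x w (k + 1) <:+ v}

/-- The total edge weight of the `k`-cut IPC; an edge is named by its endpoint away from the
root. -/
noncomputable def cutWeight (x : List ℕ → ℕ) (w : List ℕ → ℝ) (k : ℕ) : ℝ :=
  ∑ᶠ v ∈ cut x w k \ {[]}, w v

/-- The forest hanging off the `k`-th backbone vertex: the vertices by which the `k`-cut IPC
exceeds the `(k-1)`-cut IPC, apart from the `k`-th backbone vertex itself. The edges of the forest
are the edges from its vertices to their parents. -/
def forest (x : List ℕ → ℕ) (w : List ℕ → ℝ) : ℕ → Set (List ℕ)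
  | 0 => cut x w 0 \ {backbone x w 0}
  | k + 1 => (cut x w (k + 1) \ cut x w k) \ {backbone x w (k + 1)}

/-- The number of edges of the forest hanging off the `k`-th backbone vertex. -/
noncomputable def forestSize (x : List ℕ → ℕ) (w : List ℕ → ℝ) (k : ℕ) : ℕ :=
  (forest x w k).ncard

/-- The cumulative weight attached to the `k`-th backbone vertex: the increment of the total weight
from the `(k-1)`-cut to the `k`-cut IPC, without the backbone edge that leads to the `k`-th backbone
vertex. -/
noncomputable def attachedWeight (x : List ℕ → ℕ) (w : List ℕ → ℝ) : ℕ → ℝ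
  | 0 => cutWeight x w 0
  | k + 1 => cutWeight x w (k + 1) - cutWeight x w k - w (backbone x w (k + 1))

/-- The uniform distribution on `[0, a]`. -/
noncomputable def unif (a : ℝ) : Measure ℝ :=
  ProbabilityTheory.cond volume (Set.Icc 0 a)

/-- The law of the sum of `n` independent random variables that are uniform on `[0, a]`. -/
noncomputable def unifSum (a : ℝ) (n : ℕ) : Measure ℝ :=
  (Measure.pi fun _ : Fin n => unif a).map fun u => ∑ i, u i

/-- `X` and `U` are the offspring numbers and the edge weights of a branching process tree with
offspring law `ν` and i.i.d. standard uniform weights, independent of the tree. -/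
structure IsWeightedBPTree {Ω : Type*} [MeasurableSpace Ω] (P : Measure Ω) (ν : Measure ℕ)
    (X : Ω → List ℕ → ℕ) (U : Ω → List ℕ → ℝ) : Prop where
  measurable_offspring : ∀ v, Measurable fun ω => X ω v
  measurable_weight : ∀ v, Measurable fun ω => U ω v
  law : ∀ v, P.map (fun ω => (X ω v, U ω v)) = ν.prod (unif 1)
  indep : iIndepFun (fun v ω => (X ω v, U ω v)) P

/-- `ν` is a power-law offspring distribution `1 - F(x) = c x^{-α} (1 + o(1))` on `{1, 2, …}`. -/
structure IsPowerLawOffspring (ν : Measure ℕ) (α c : ℝ) : Prop where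
  exponent_pos : 0 < α
  constant_pos : 0 < c
  zero_null : ν {0} = 0
  tail : Tendsto (fun x : ℝ => ν.real {n : ℕ | x < n} / (c * x ^ (-α))) atTop (𝓝 1)

end InvasionPercolation

open InvasionPercolation

/-! The percolation threshold of a subtree is the smallest level at which it contains an infinite
path of weights at most that level. Two facts govern the cluster. Once `u` is invaded, no edge
heavier than the threshold of `u` is used again (`weight_le_threshold_of_notMem_invaded`). A vertex
joined to an invaded `u` by edges lighter than some cluster edge below `u` is itself invaded
(`mem_cluster_of_lt`). If sibling branches have distinct thresholds, the backbone therefore always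
enters the branch of smallest threshold, the other branches are invaded only finitely far, and `W_k`
is the threshold at `v_k` (`IsRegular.coe_futureMax`). The forest at `v_k = u` consists of the
vertices off the next backbone branch that are joined to `u` by edges below a level `m`, the branch
threshold of the next backbone vertex `j :: u`.

Thus "the forest is `F`" has a local description (`IsRegular.forest_eq_iff`): `u` is selected, edges
of `F` lie below `m`, and the other edges at `F` and `u`, except the one to `j :: u`, lie above `m`.
The level `m` does not involve the weights on `F`, and replacing these by any values below `m`
changes neither the selection of `u` nor the forest (`IsLocalForest.resample`). The weights on `F`
are i.i.d. uniform on `[0, 1]` and independent of the rest of the configuration, so on this event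
they are uniform on `[0, m]` given the rest (`measure_and_lt_level`, applied in
`IsWeightedBPTree.measure_restrict_localEvent`). Summation over the countably many `u`, `j` gives
the law of the weights for fixed `F`; pushing it forward under the sum, adding over `F` and
averaging over the forest size gives the law of the attached weight.

The probabilistic input is almost sure regularity (`IsWeightedBPTree.ae_isRegular`), where the point
is that thresholds have no atoms. The probability that the threshold is at most `p` is a fixed point
of `s ↦ keepProb ν (weightCDF p * s)`, and strict concavity of `keepProb ν`, due to `ν {n | 2 ≤ n} ≠
0`, makes it left-continuous in `p` (`IsWeightedBPTree.measureReal_threshold_lt`). -/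

open scoped ENNReal

namespace InvasionPercolation

section

variable {x : List ℕ → ℕ} {w w' : List ℕ → ℝ}

/-! ### Percolation thresholds -/

/-- The smallest level `p` at which `v` is the start of a descending path of length `n` all of whose
edges have weight at most `p`. -/
noncomputable def thresholdAux (x : List ℕ → ℕ) (w : List ℕ → ℝ) : ℕ → List ℕ → EReal
  | 0, _ => ⊥
  | n + 1, v => (Finset.range (x v)).inf fun i =>
      max (w (i :: v) : EReal) (thresholdAux x w n (i :: v))

/-- The percolation threshold of the subtree of the descendants of `v`. -/
noncomputable def threshold (x : List ℕ → ℕ) (w : List ℕ → ℝ) (v : List ℕ) : EReal :=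
  ⨆ n, thresholdAux x w n v

/-- The percolation threshold of the branch that consists of `v`, its descendants, and the edge that
leads to `v`. -/
noncomputable def branchThreshold (x : List ℕ → ℕ) (w : List ℕ → ℝ) (v : List ℕ) : EReal :=
  max (w v : EReal) (threshold x w v)

theorem thresholdAux_le_succ (n : ℕ) (v : List ℕ) :
    thresholdAux x w n v ≤ thresholdAux x w (n + 1) v := by
  induction n generalizing v with
  | zero => exact bot_le
  | succ n ih =>
    rw [thresholdAux, thresholdAux]
    exact Finset.inf_mono_fun fun i _ => max_le_max le_rfl (ih _)

theorem thresholdAux_mono (v : List ℕ) : Monotone fun n => thresholdAux x w n v :=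
  monotone_nat_of_le_succ fun n => thresholdAux_le_succ n v

theorem thresholdAux_le_threshold (n : ℕ) (v : List ℕ) :
    thresholdAux x w n v ≤ threshold x w v :=
  le_iSup (fun n => thresholdAux x w n v) n

/-- A compactness argument: there are finitely many children and the truncated thresholds increase
with depth, so one depth serves all children and the supremum passes through the minimum. -/
theorem threshold_eq_inf (v : List ℕ) :
    threshold x w v = (Finset.range (x v)).inf fun i => branchThreshold x w (i :: v) := by
  apply le_antisymm
  · refine iSup_le fun n => (thresholdAux_le_succ n v).trans ?_
    exact Finset.inf_mono_fun fun i _ => max_le_max le_rfl (thresholdAux_le_threshold _ _)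
  · by_contra! h
    have h1 : ∀ i ∈ Finset.range (x v), ∃ n, threshold x w v <
        max (w (i :: v) : EReal) (thresholdAux x w n (i :: v)) := by
      intro i hi
      have := (Finset.lt_inf_iff (h.trans_le le_top)).1 h i hi
      rcases lt_max_iff.1 this with h | h
      · exact ⟨0, lt_max_of_lt_left h⟩
      · obtain ⟨n, hn⟩ := lt_iSup_iff.1 h
        exact ⟨n, lt_max_of_lt_right hn⟩
    choose! N hN using h1
    have : threshold x w v < thresholdAux x w ((Finset.range (x v)).sup N + 1) v := by
      rw [thresholdAux, Finset.lt_inf_iff (h.trans_le le_top)]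
      intro i hi
      exact (hN i hi).trans_le
        (max_le_max le_rfl (thresholdAux_mono _ (Finset.le_sup (f := N) hi)))
    exact absurd this (not_lt.2 (thresholdAux_le_threshold _ _))

theorem threshold_le_branchThreshold {i : ℕ} {v : List ℕ} (hi : i < x v) :
    threshold x w v ≤ branchThreshold x w (i :: v) := by
  rw [threshold_eq_inf]
  exact Finset.inf_le (Finset.mem_range.2 hi)

theorem threshold_le_one (hx : ∀ v, 1 ≤ x v) (hw : ∀ v, w v ≤ 1) (v : List ℕ) :
    threshold x w v ≤ 1 := by
  refine iSup_le fun n => ?_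
  induction n generalizing v with
  | zero => exact bot_le
  | succ n ih =>
    rw [thresholdAux]
    refine (Finset.inf_le (Finset.mem_range.2 (hx v))).trans (max_le ?_ (ih _))
    exact_mod_cast hw _

theorem branchThreshold_le_one (hx : ∀ v, 1 ≤ x v) (hw : ∀ v, w v ≤ 1) (v : List ℕ) :
    branchThreshold x w v ≤ 1 :=
  max_le (by exact_mod_cast hw _) (threshold_le_one hx hw v)

theorem thresholdAux_congr {x' : List ℕ → ℕ} {v : List ℕ} (n : ℕ)
    (hx : ∀ y, v <:+ y → x y = x' y) (hw : ∀ y, v <:+ y → y ≠ v → w y = w' y) :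
    thresholdAux x w n v = thresholdAux x' w' n v := by
  induction n generalizing v with
  | zero => rfl
  | succ n ih =>
    rw [thresholdAux, thresholdAux, hx v (List.suffix_refl v)]
    refine Finset.inf_congr rfl fun i _ => ?_
    have hs : v <:+ i :: v := List.suffix_cons i v
    rw [hw _ hs (by simp), ih (fun y hy => hx y (hs.trans hy))]
    intro y hy hne
    refine hw y (hs.trans hy) ?_
    rintro rfl
    have := hy.length_le
    simp at this

theorem threshold_congr {x' : List ℕ → ℕ} {v : List ℕ}
    (hx : ∀ y, v <:+ y → x y = x' y) (hw : ∀ y, v <:+ y → y ≠ v → w y = w' y) :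
    threshold x w v = threshold x' w' v :=
  iSup_congr fun n => thresholdAux_congr n hx hw

theorem branchThreshold_congr {x' : List ℕ → ℕ} {v : List ℕ}
    (hx : ∀ y, v <:+ y → x y = x' y) (hw : ∀ y, v <:+ y → w y = w' y) :
    branchThreshold x w v = branchThreshold x' w' v := by
  rw [branchThreshold, branchThreshold, hw v (List.suffix_refl v),
    threshold_congr hx fun y hy _ => hw y hy]

/-! ### Paths -/

theorem cons_mem_treeVertices {i : ℕ} {v : List ℕ} :
    i :: v ∈ treeVertices x ↔ v ∈ treeVertices x ∧ i < x v := by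
  constructor
  · intro h
    exact ⟨fun j u hu => h j u (hu.trans (List.suffix_cons i v)), h i v (List.suffix_refl _)⟩
  · rintro ⟨h, hi⟩ j u hu
    rcases List.suffix_cons_iff.1 hu with h' | h'
    · obtain ⟨rfl, rfl⟩ := List.cons.inj h'
      exact hi
    · exact h j u h'

theorem nil_mem_treeVertices : [] ∈ treeVertices x := by
  intro i u h
  simp at h

/-- Follow minimizing children. The level must be below `⊤` because the minimum over no children is
`⊤`, and then there is no child to follow. -/
theorem exists_path_of_thresholdAux_le {p : EReal} (hp : p < ⊤) {v : List ℕ} (n : ℕ)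
    (h : thresholdAux x w n v ≤ p) (hv : v ∈ treeVertices x) :
    ∃ y ∈ treeVertices x, v <:+ y ∧ y.length = v.length + n ∧
      ∀ z, v <:+ z → z <:+ y → z ≠ v → (w z : EReal) ≤ p := by
  induction n generalizing v with
  | zero =>
    refine ⟨v, hv, List.suffix_refl v, rfl, fun z h1 h2 h3 => ?_⟩
    exact absurd (h2.eq_of_length (le_antisymm h2.length_le h1.length_le)) h3
  | succ n ih =>
    rw [thresholdAux, Finset.inf_le_iff hp] at h
    obtain ⟨i, hi, h⟩ := h
    obtain ⟨y, hy, hs, hl, hz⟩ := ih ((le_max_right _ _).trans h)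
      (cons_mem_treeVertices.2 ⟨hv, Finset.mem_range.1 hi⟩)
    refine ⟨y, hy, (List.suffix_cons i v).trans hs, by rw [hl, List.length_cons]; omega, ?_⟩
    intro z h1 h2 h3
    rcases List.suffix_or_suffix_of_suffix h2 hs with h4 | h4
    · rcases List.suffix_cons_iff.1 h4 with rfl | h5
      · exact (le_max_left _ _).trans h
      · exact absurd (h5.eq_of_length (le_antisymm h5.length_le h1.length_le)) h3
    · by_cases h5 : z = i :: v
      · rw [h5]
        exact (le_max_left _ _).trans h
      · exact hz z h4 h2 h5

theorem thresholdAux_le_of_ray {p : EReal} {b : ℕ → List ℕ}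
    (hb : ∀ k, ∃ i < x (b k), b (k + 1) = i :: b k) (k n : ℕ)
    (hp : ∀ l, k < l → (w (b l) : EReal) ≤ p) : thresholdAux x w n (b k) ≤ p := by
  induction n generalizing k with
  | zero => exact bot_le
  | succ n ih =>
    obtain ⟨i, hi, h⟩ := hb k
    rw [thresholdAux]
    refine (Finset.inf_le (Finset.mem_range.2 hi)).trans ?_
    rw [← h]
    exact max_le (hp _ (Nat.lt_succ_self k)) (ih _ fun l hl => hp l (by omega))

/-- Supplies a boundary vertex on any path that leaves an invaded set or a finite forest. -/
theorem exists_exit {S : Set (List ℕ)} {u y : List ℕ} (hu : u ∈ S) (hy : y ∉ S) (h : u <:+ y) :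
    ∃ i z, i :: z <:+ y ∧ u <:+ z ∧ z ∈ S ∧ i :: z ∉ S := by
  induction y with
  | nil =>
    rw [List.suffix_nil.1 h] at hu
    exact absurd hu hy
  | cons i y ih =>
    rcases List.suffix_cons_iff.1 h with rfl | h'
    · exact absurd hu hy
    · by_cases hyS : y ∈ S
      · exact ⟨i, y, List.suffix_refl _, h', hyS, hy⟩
      · obtain ⟨j, z, h1, h2⟩ := ih hyS h'
        exact ⟨j, z, h1.trans (List.suffix_cons i y), h2⟩

theorem mem_treeVertices_of_suffix {u v : List ℕ} (hv : v ∈ treeVertices x) (h : u <:+ v) :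
    u ∈ treeVertices x := fun i z hz => hv i z (hz.trans h)

theorem ne_of_suffix_of_cons_suffix {i : ℕ} {u z : List ℕ} (h : u <:+ z) : i :: z ≠ u := by
  rintro rfl
  have := h.length_le
  simp at this

/-! ### Invasion -/

theorem finite_boundary {S : Set (List ℕ)} (hS : S.Finite) : (boundary x S).Finite := by
  refine (hS.biUnion fun u _ => (Set.finite_Iio (x u)).image fun i => i :: u).subset ?_
  rintro v ⟨h1, -, i, u, hu, rfl⟩
  exact Set.mem_biUnion hu ⟨i, (cons_mem_treeVertices.1 h1).2, rfl⟩

theorem finite_invaded (n : ℕ) : (invaded x w n).Finite := by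
  induction n with
  | zero => exact Set.finite_singleton _
  | succ n ih => exact ih.union ((finite_boundary ih).subset fun v hv => hv.1)

theorem invaded_mono : Monotone (invaded x w) :=
  monotone_nat_of_le_succ fun _ => Set.subset_union_left

theorem invaded_subset_treeVertices (n : ℕ) : invaded x w n ⊆ treeVertices x := by
  induction n with
  | zero => rintro v rfl; exact nil_mem_treeVertices
  | succ n ih => exact Set.union_subset ih fun v hv => hv.1.1

theorem cluster_subset_treeVertices : cluster x w ⊆ treeVertices x :=
  Set.iUnion_subset invaded_subset_treeVertices

theorem nil_mem_invaded (n : ℕ) : [] ∈ invaded x w n :=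
  invaded_mono (Nat.zero_le n) rfl

theorem parent_mem_invaded {n i : ℕ} {v : List ℕ} (h : i :: v ∈ invaded x w (n + 1)) :
    v ∈ invaded x w n := by
  induction n with
  | zero =>
    rcases h with h | ⟨⟨-, -, j, u, hu, he⟩, -⟩
    · simp [invaded] at h
    · obtain ⟨rfl, rfl⟩ := List.cons.inj he
      exact hu
  | succ n ih =>
    rcases h with h | ⟨⟨-, -, j, u, hu, he⟩, -⟩
    · exact invaded_mono (Nat.le_succ n) (ih h)
    · obtain ⟨rfl, rfl⟩ := List.cons.inj he
      exact hu

theorem parent_mem_cluster {i : ℕ} {v : List ℕ} (h : i :: v ∈ cluster x w) :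
    v ∈ cluster x w := by
  obtain ⟨n, hn⟩ := Set.mem_iUnion.1 h
  exact Set.mem_iUnion.2 ⟨n, parent_mem_invaded (invaded_mono (Nat.le_succ n) hn)⟩

theorem mem_cluster_of_suffix {u v : List ℕ} (h : u <:+ v) (hv : v ∈ cluster x w) :
    u ∈ cluster x w := by
  induction v with
  | nil => rwa [List.suffix_nil.1 h]
  | cons i v ih =>
    rcases List.suffix_cons_iff.1 h with rfl | h'
    · exact hv
    · exact ih h' (parent_mem_cluster hv)

theorem weight_le_of_mem_boundary {m : ℕ} {u v : List ℕ}
    (hu : u ∈ boundary x (invaded x w m)) (hv : v ∈ invaded x w (m + 1)) (hv' : v ∉ invaded x w m) :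
    w v ≤ w u := by
  rcases hv with hv | hv
  · exact absurd hv hv'
  · exact hv.2 u hu

theorem exists_invasion_step {v : List ℕ} {n : ℕ} (hv : v ∈ cluster x w)
    (hvn : v ∉ invaded x w n) : ∃ m, n ≤ m ∧ v ∈ invaded x w (m + 1) ∧ v ∉ invaded x w m := by
  classical
  have hex : ∃ m, v ∈ invaded x w m := Set.mem_iUnion.1 hv
  have hspec := Nat.find_spec hex
  cases h0 : Nat.find hex with
  | zero =>
    rw [h0] at hspec
    exact absurd (invaded_mono (Nat.zero_le n) hspec) hvn
  | succ m =>
    rw [h0] at hspec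
    refine ⟨m, ?_, hspec, Nat.find_min hex (by omega)⟩
    by_contra! h
    exact hvn (invaded_mono (by omega) hspec)

/-- From the time when `u` is invaded, all newly invaded edges have at most the weight
`threshold x w u`. -/
theorem weight_le_threshold_of_notMem_invaded {u v : List ℕ} {n : ℕ} (htop : threshold x w u < ⊤)
    (hu : u ∈ invaded x w n) (hv : v ∈ cluster x w) (hvn : v ∉ invaded x w n) :
    (w v : EReal) ≤ threshold x w u := by
  obtain ⟨m, hnm, hm, hm'⟩ := exists_invasion_step hv hvn
  have huT : u ∈ invaded x w m := invaded_mono hnm hu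
  -- A path below `u` that is longer than the depth of the invaded set and stays within the
  -- threshold must leave this set. The edge where it leaves competes with that of `v` at step `m +
  -- 1`.
  obtain ⟨L, hL⟩ := ((finite_invaded (x := x) (w := w) m).image List.length).bddAbove
  obtain ⟨y, hy, huy, hl, hz⟩ := exists_path_of_thresholdAux_le htop (L + 1)
    (thresholdAux_le_threshold _ _) (invaded_subset_treeVertices m huT)
  have hyn : y ∉ invaded x w m := fun h => by
    have := hL ⟨y, h, rfl⟩
    omega
  obtain ⟨i, z, h1, h2, h3, h4⟩ := exists_exit huT hyn huy
  have hb : i :: z ∈ boundary x (invaded x w m) :=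
    ⟨mem_treeVertices_of_suffix hy h1, h4, i, z, h3, rfl⟩
  refine le_trans ?_ (hz (i :: z) (h2.trans (List.suffix_cons i z)) h1
    (ne_of_suffix_of_cons_suffix h2))
  exact_mod_cast weight_le_of_mem_boundary hb hm hm'

/-- Take the first time at which `u` is invaded. A proper descendant present then would have had its
parent present one step earlier, and climbing up would give an earlier time for `u`. -/
theorem exists_first_invaded {u : List ℕ} (hu : u ∈ cluster x w) :
    ∃ n, u ∈ invaded x w n ∧ ∀ v, u <:+ v → v ≠ u → v ∉ invaded x w n := by
  classical
  have hex : ∃ m, u ∈ invaded x w m := Set.mem_iUnion.1 hu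
  refine ⟨Nat.find hex, Nat.find_spec hex, fun v => ?_⟩
  induction v with
  | nil => intro h1 h2; exact absurd (List.suffix_nil.1 h1).symm h2
  | cons i v ih =>
    intro h1 h2 h3
    rcases List.suffix_cons_iff.1 h1 with rfl | h4
    · exact h2 rfl
    · cases hn : Nat.find hex with
      | zero =>
        rw [hn] at h3
        simp [invaded] at h3
      | succ n =>
        rw [hn] at h3
        have h5 := parent_mem_invaded h3
        by_cases h6 : v = u
        · rw [h6] at h5
          exact Nat.find_min hex (by omega) h5
        · exact ih h4 h6 (hn ▸ invaded_mono (Nat.le_succ n) h5)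

theorem weight_le_threshold {u v : List ℕ} (htop : threshold x w u < ⊤)
    (hv : v ∈ cluster x w) (h : u <:+ v) (hne : v ≠ u) : (w v : EReal) ≤ threshold x w u := by
  obtain ⟨n, h1, h2⟩ := exists_first_invaded (mem_cluster_of_suffix h hv)
  exact weight_le_threshold_of_notMem_invaded htop h1 hv (h2 v h hne)

/-- A vertex that is joined to the invaded vertex `u` by edges lighter than an edge which is invaded
below `u` is invaded, too. -/
theorem mem_cluster_of_lt {u v y : List ℕ} (hv : v ∈ cluster x w) (huv : u <:+ v) (hne : v ≠ u)
    (hy : y ∈ treeVertices x) (huy : u <:+ y)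
    (h : ∀ z, u <:+ z → z <:+ y → z ≠ u → w z < w v) : y ∈ cluster x w := by
  obtain ⟨n, hn, hn'⟩ := exists_first_invaded (mem_cluster_of_suffix huv hv)
  obtain ⟨m, hnm, hm1, hm2⟩ := exists_invasion_step hv (hn' v huv hne)
  by_contra hyT
  have hym : y ∉ invaded x w m := fun h => hyT (Set.mem_iUnion.2 ⟨m, h⟩)
  obtain ⟨i, z, h1, h2, h3, h4⟩ := exists_exit (invaded_mono hnm hn) hym huy
  have hb : i :: z ∈ boundary x (invaded x w m) :=
    ⟨mem_treeVertices_of_suffix hy h1, h4, i, z, h3, rfl⟩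
  exact absurd (weight_le_of_mem_boundary hb hm1 hm2) (not_le.2
    (h _ (h2.trans (List.suffix_cons i z)) h1 (ne_of_suffix_of_cons_suffix h2)))

end

section

variable {x : List ℕ → ℕ} {w w' : List ℕ → ℝ}

/-! ### The backbone -/

/-- The properties of a realisation of the weighted tree that hold almost surely and that determine
the shape of the invasion percolation cluster. -/
structure IsRegular (x : List ℕ → ℕ) (w : List ℕ → ℝ) : Prop where
  one_le_offspring : ∀ v, 1 ≤ x v
  pos : ∀ v, 0 < w v
  le_one : ∀ v, w v ≤ 1
  injective : Function.Injective w
  branchThreshold_ne : ∀ v i j, i ≠ j →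
    branchThreshold x w (i :: v) ≠ branchThreshold x w (j :: v)
  threshold_ne : ∀ y z, ¬ z <:+ y → threshold x w z ≠ w y

/-- `j` is the child of `v` whose branch has the strictly smallest threshold. -/
def IsMinChild (x : List ℕ → ℕ) (w : List ℕ → ℝ) (v : List ℕ) (j : ℕ) : Prop :=
  j < x v ∧ ∀ i < x v, i ≠ j → branchThreshold x w (j :: v) < branchThreshold x w (i :: v)

/-- The path from the root to `v` always moves to the child of minimal branch threshold. -/
def IsSelected (x : List ℕ → ℕ) (w : List ℕ → ℝ) (v : List ℕ) : Prop :=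
  ∀ i z, i :: z <:+ v → IsMinChild x w z i

theorem IsMinChild.unique {v : List ℕ} {i j : ℕ} (hi : IsMinChild x w v i)
    (hj : IsMinChild x w v j) : i = j := by
  by_contra h
  exact lt_asymm (hi.2 j hj.1 (Ne.symm h)) (hj.2 i hi.1 h)

theorem IsMinChild.threshold_eq {v : List ℕ} {j : ℕ} (hj : IsMinChild x w v j) :
    threshold x w v = branchThreshold x w (j :: v) := by
  refine le_antisymm (threshold_le_branchThreshold hj.1) ?_
  rw [threshold_eq_inf]
  refine Finset.le_inf fun i hi => ?_
  by_cases h : i = j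
  · rw [h]
  · exact (hj.2 i (Finset.mem_range.1 hi) h).le

theorem isSelected_nil : IsSelected x w [] := by
  intro i z h
  simp at h

theorem isSelected_cons {i : ℕ} {v : List ℕ} :
    IsSelected x w (i :: v) ↔ IsSelected x w v ∧ IsMinChild x w v i := by
  constructor
  · intro h
    exact ⟨fun j u hu => h j u (hu.trans (List.suffix_cons i v)), h i v (List.suffix_refl _)⟩
  · rintro ⟨h, hi⟩ j u hu
    rcases List.suffix_cons_iff.1 hu with h' | h'
    · obtain ⟨rfl, rfl⟩ := List.cons.inj h'
      exact hi
    · exact h j u h'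

theorem IsSelected.unique {u v : List ℕ} (hu : IsSelected x w u) (hv : IsSelected x w v)
    (h : u.length = v.length) : u = v := by
  induction u generalizing v with
  | nil => exact (List.length_eq_zero_iff.1 h.symm).symm
  | cons i u ih =>
    cases v with
    | nil => simp at h
    | cons j v =>
      rw [isSelected_cons] at hu hv
      have huv := ih hu.1 hv.1 (by simpa using h)
      subst huv
      rw [hu.2.unique hv.2]

theorem exists_cons_suffix {v y : List ℕ} (h : v <:+ y) (hne : y ≠ v) : ∃ i, i :: v <:+ y := by
  obtain ⟨t, rfl⟩ := h
  rcases List.eq_nil_or_concat t with rfl | ⟨t', i, rfl⟩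
  · simp at hne
  · exact ⟨i, t', by simp⟩

/-- Below the threshold, some truncated threshold already exceeds `p`; paths at level `p` then die
out within a fixed number of generations, and branching is finite. -/
theorem finite_path_set {p : EReal} {v : List ℕ} (hp : p < threshold x w v) :
    {y | y ∈ treeVertices x ∧ v <:+ y ∧
      ∀ z, v <:+ z → z <:+ y → z ≠ v → (w z : EReal) ≤ p}.Finite := by
  obtain ⟨n, hn⟩ := lt_iSup_iff.1 hp
  clear hp
  induction n generalizing v with
  | zero => exact absurd hn not_lt_bot
  | succ n ih =>
    rw [thresholdAux, Finset.lt_inf_iff (hn.trans_le le_top)] at hn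
    have hfin : ∀ i < x v, {y | y ∈ treeVertices x ∧ i :: v <:+ y ∧
        ∀ z, v <:+ z → z <:+ y → z ≠ v → (w z : EReal) ≤ p}.Finite := by
      intro i hi
      rcases lt_max_iff.1 (hn i (Finset.mem_range.2 hi)) with h | h
      · convert Set.finite_empty (α := List ℕ)
        refine Set.eq_empty_iff_forall_notMem.2 ?_
        rintro y ⟨-, h2, h3⟩
        exact not_le.2 h (h3 _ (List.suffix_cons i v) h2 (by simp))
      · refine (ih h).subset ?_
        rintro y ⟨h1, h2, h3⟩
        refine ⟨h1, h2, fun z hz1 hz2 _ => h3 z ((List.suffix_cons i v).trans hz1) hz2 ?_⟩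
        rintro rfl
        have := hz1.length_le
        simp at this
    refine ((Set.finite_singleton v).union
      ((Set.finite_Iio (x v)).biUnion fun i hi => hfin i hi)).subset ?_
    rintro y ⟨h1, h2, h3⟩
    by_cases hy : y = v
    · exact Or.inl hy
    · obtain ⟨i, hi⟩ := exists_cons_suffix h2 hy
      exact Or.inr (Set.mem_biUnion (show i ∈ Set.Iio (x v) from
        (cons_mem_treeVertices.1 (mem_treeVertices_of_suffix h1 hi)).2) ⟨h1, hi, h3⟩)

/-! ### Existence of the backbone -/

namespace IsRegular

variable (h : IsRegular x w)
include h

theorem threshold_lt_top (v : List ℕ) : threshold x w v < ⊤ :=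
  (threshold_le_one h.one_le_offspring h.le_one v).trans_lt (EReal.coe_lt_top 1)

theorem branchThreshold_lt_top (v : List ℕ) : branchThreshold x w v < ⊤ :=
  (branchThreshold_le_one h.one_le_offspring h.le_one v).trans_lt (EReal.coe_lt_top 1)

/-- A finite cluster would be complete at some step. Arbitrarily long paths exist, so the boundary
would still be nonempty, and its lightest vertex would be added next. -/
theorem infinite_cluster : (cluster x w).Infinite := by
  intro hfin
  have hmem : ∀ v ∈ cluster x w, ∃ n, v ∈ invaded x w n := fun v hv => Set.mem_iUnion.1 hv
  choose! N hN using hmem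
  set m := hfin.toFinset.sup N
  have hsub : cluster x w ⊆ invaded x w m := fun v hv =>
    invaded_mono (Finset.le_sup (f := N) (hfin.mem_toFinset.2 hv)) (hN v hv)
  obtain ⟨L, hL⟩ := ((finite_invaded (x := x) (w := w) m).image List.length).bddAbove
  obtain ⟨y, hy, hs, hl, -⟩ := exists_path_of_thresholdAux_le (h.threshold_lt_top []) (L + 1)
    (thresholdAux_le_threshold _ _) nil_mem_treeVertices
  have hyn : y ∉ invaded x w m := fun h => by
    have := hL ⟨y, h, rfl⟩
    simp at hl
    omega
  obtain ⟨i, z, h1, h2, h3, h4⟩ := exists_exit (nil_mem_invaded m) hyn hs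
  have hb : i :: z ∈ boundary x (invaded x w m) :=
    ⟨mem_treeVertices_of_suffix hy h1, h4, i, z, h3, rfl⟩
  obtain ⟨v, hv, hmin⟩ := (finite_boundary (x := x) (finite_invaded m)).exists_minimalFor w _ ⟨_, hb⟩
  have hv' : v ∈ invaded x w (m + 1) := by
    refine Or.inr ⟨hv, fun u hu => ?_⟩
    rcases le_total (w v) (w u) with h | h
    · exact h
    · exact hmin hu h
  exact hv.2.1 (hsub (Set.mem_iUnion.2 ⟨m + 1, hv'⟩))

theorem exists_isMinChild (v : List ℕ) : ∃ j, IsMinChild x w v j := by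
  obtain ⟨j, hj, hmin⟩ := Finset.exists_min_image (Finset.range (x v))
    (fun i => branchThreshold x w (i :: v)) ⟨0, Finset.mem_range.2 (h.one_le_offspring v)⟩
  exact ⟨j, Finset.mem_range.1 hj, fun i hi hij => lt_of_le_of_ne (hmin i (Finset.mem_range.2 hi))
    (h.branchThreshold_ne v j i hij.symm)⟩

/-- Cluster edges below `v` weigh at most the threshold of `v`, which is strictly less than the
branch threshold of `i :: v`. Either the edge to `i :: v` is too heavy, and the branch is never
entered, or the subtree of `i :: v` is subcritical at this level. -/
theorem finite_cluster_of_ne {v : List ℕ} {i j : ℕ} (hj : IsMinChild x w v j) (hij : i ≠ j) :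
    {y | y ∈ cluster x w ∧ i :: v <:+ y}.Finite := by
  by_cases hi : i < x v
  swap
  · convert Set.finite_empty (α := List ℕ)
    refine Set.eq_empty_iff_forall_notMem.2 ?_
    rintro y ⟨h1, h2⟩
    exact hi (cons_mem_treeVertices.1
      (mem_treeVertices_of_suffix (cluster_subset_treeVertices h1) h2)).2
  have hle : ∀ y ∈ cluster x w, i :: v <:+ y → ∀ z, i :: v <:+ z → z <:+ y →
      (w z : EReal) ≤ threshold x w v := by
    intro y hy _ z hz1 hz2
    refine weight_le_threshold (h.threshold_lt_top v) (mem_cluster_of_suffix hz2 hy)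
      ((List.suffix_cons i v).trans hz1) ?_
    rintro rfl
    have := hz1.length_le
    simp at this
  have hlt := hj.2 i hi hij
  rw [← hj.threshold_eq] at hlt
  rcases lt_max_iff.1 hlt with h1 | h1
  · convert Set.finite_empty (α := List ℕ)
    refine Set.eq_empty_iff_forall_notMem.2 ?_
    rintro y ⟨hy, hs⟩
    exact not_le.2 h1 (hle y hy hs _ (List.suffix_refl _) hs)
  · refine (finite_path_set h1).subset ?_
    rintro y ⟨hy, hs⟩
    exact ⟨cluster_subset_treeVertices hy, hs, fun z hz1 hz2 _ => hle y hy hs z hz1 hz2⟩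

theorem finite_cluster_off {v : List ℕ} {j : ℕ} (hj : IsMinChild x w v j) :
    {y | y ∈ cluster x w ∧ v <:+ y ∧ ¬ j :: v <:+ y}.Finite := by
  have : ∀ i ∈ Set.Iio (x v), {y | (y ∈ cluster x w ∧ i :: v <:+ y) ∧ i ≠ j}.Finite := by
    intro i _
    by_cases hij : i = j
    · simp [hij]
    · exact (h.finite_cluster_of_ne hj hij).subset fun y hy => hy.1
  refine ((Set.finite_singleton v).union ((Set.finite_Iio (x v)).biUnion this)).subset ?_
  rintro y ⟨h1, h2, h3⟩
  by_cases hy : y = v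
  · exact Or.inl hy
  · obtain ⟨i, hi⟩ := exists_cons_suffix h2 hy
    refine Or.inr (Set.mem_biUnion (show i ∈ Set.Iio (x v) from (cons_mem_treeVertices.1
      (mem_treeVertices_of_suffix (cluster_subset_treeVertices h1) hi)).2) ⟨⟨h1, hi⟩, ?_⟩)
    rintro rfl
    exact h3 hi

theorem infinite_cluster_of_isMinChild {v : List ℕ} {j : ℕ} (hj : IsMinChild x w v j)
    (hv : {y | y ∈ cluster x w ∧ v <:+ y}.Infinite) :
    {y | y ∈ cluster x w ∧ j :: v <:+ y}.Infinite := by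
  intro hfin
  refine hv ((hfin.union (h.finite_cluster_off hj)).subset ?_)
  rintro y ⟨h1, h2⟩
  by_cases h3 : j :: v <:+ y
  · exact Or.inl ⟨h1, h3⟩
  · exact Or.inr ⟨h1, h2, h3⟩

theorem exists_isBackbone : ∃ b, IsBackbone x w b := by
  choose f hf using h.exists_isMinChild
  let b : ℕ → List ℕ := fun k => Nat.rec [] (fun _ v => f v :: v) k
  -- The infinite part of the cluster is passed on to the minimal child, since the other branches
  -- hold finitely many of its vertices.
  have hinf : ∀ k, {y | y ∈ cluster x w ∧ b k <:+ y}.Infinite := by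
    intro k
    induction k with
    | zero => simpa [b] using h.infinite_cluster
    | succ k ih => exact h.infinite_cluster_of_isMinChild (hf _) ih
  refine ⟨b, rfl, fun k => ⟨f (b k), rfl⟩, fun k => ?_⟩
  obtain ⟨y, hy, hs⟩ := (hinf k).nonempty
  exact mem_cluster_of_suffix hs hy

end IsRegular

/-! ### Uniqueness of the backbone, future maxima and cuts -/

theorem IsBackbone.length_eq {b : ℕ → List ℕ} (hb : IsBackbone x w b) (k : ℕ) :
    (b k).length = k := by
  induction k with
  | zero => rw [hb.1]; rfl
  | succ k ih =>
    obtain ⟨i, hi⟩ := hb.2.1 k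
    rw [hi, List.length_cons, ih]

theorem IsBackbone.suffix {b : ℕ → List ℕ} (hb : IsBackbone x w b) {k l : ℕ} (hkl : k ≤ l) :
    b k <:+ b l := by
  induction hkl with
  | refl => exact List.suffix_refl _
  | step _ ih =>
    obtain ⟨i, hi⟩ := hb.2.1 _
    rw [hi]
    exact ih.trans (List.suffix_cons i _)

theorem IsBackbone.infinite {b : ℕ → List ℕ} (hb : IsBackbone x w b) (k : ℕ) :
    {y | y ∈ cluster x w ∧ b k <:+ y}.Infinite := by
  refine Set.infinite_of_injective_forall_mem (f := fun n => b (k + n)) ?_ fun n =>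
    ⟨hb.2.2 _, hb.suffix (Nat.le_add_right k n)⟩
  intro m n hmn
  have := congrArg List.length hmn
  simp only [hb.length_eq] at this
  omega

/-- A path to infinity cannot enter a branch in which the cluster is finite. -/
theorem IsBackbone.isMinChild (h : IsRegular x w) {b : ℕ → List ℕ} (hb : IsBackbone x w b) (k : ℕ) :
    ∃ i, b (k + 1) = i :: b k ∧ IsMinChild x w (b k) i := by
  obtain ⟨i, hi⟩ := hb.2.1 k
  obtain ⟨j, hj⟩ := h.exists_isMinChild (b k)
  have hij : i = j := by
    by_contra hij
    have := hb.infinite (k + 1)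
    rw [hi] at this
    exact this (h.finite_cluster_of_ne hj hij)
  exact ⟨i, hi, hij ▸ hj⟩

theorem IsBackbone.isSelected (h : IsRegular x w) {b : ℕ → List ℕ} (hb : IsBackbone x w b) (k : ℕ) :
    IsSelected x w (b k) := by
  induction k with
  | zero => rw [hb.1]; exact isSelected_nil
  | succ k ih =>
    obtain ⟨i, hi, hm⟩ := hb.isMinChild h k
    rw [hi, isSelected_cons]
    exact ⟨ih, hm⟩

namespace IsRegular

variable (h : IsRegular x w)
include h

theorem existsUnique_isBackbone : ∃! b, IsBackbone x w b := by
  obtain ⟨b, hb⟩ := h.exists_isBackbone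
  refine ⟨b, hb, fun b' hb' => funext fun k => ?_⟩
  exact (hb'.isSelected h k).unique (hb.isSelected h k) (by rw [hb.length_eq, hb'.length_eq])

theorem isBackbone_backbone : IsBackbone x w (backbone x w) :=
  Classical.epsilon_spec h.exists_isBackbone

theorem backbone_eq {u : List ℕ} (hu : IsSelected x w u) : backbone x w u.length = u :=
  (h.isBackbone_backbone.isSelected h _).unique hu (h.isBackbone_backbone.length_eq _)

theorem bddAbove_futureMax (k : ℕ) : BddAbove {β | ∃ i, k < i ∧ β = w (backbone x w i)} :=
  ⟨1, by rintro _ ⟨i, -, rfl⟩; exact h.le_one _⟩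

/-- All cluster edges below the `k`-th backbone vertex respect its threshold; conversely, the rest
of the backbone is an infinite path at the level of its own supremum. -/
theorem coe_futureMax (k : ℕ) :
    (futureMax x w k : EReal) = threshold x w (backbone x w k) := by
  have hb := h.isBackbone_backbone
  have hray : ∀ k, ∃ i < x (backbone x w k), backbone x w (k + 1) = i :: backbone x w k := by
    intro k
    obtain ⟨i, hi, hm⟩ := hb.isMinChild h k
    exact ⟨i, hm.1, hi⟩
  apply le_antisymm
  · have hle : ∀ i, k < i → (w (backbone x w i) : EReal) ≤ threshold x w (backbone x w k) := by
      intro i hi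
      refine weight_le_threshold (h.threshold_lt_top _) (hb.2.2 i) (hb.suffix hi.le) fun he => ?_
      have := congrArg List.length he
      rw [hb.length_eq, hb.length_eq] at this
      omega
    have hbot : threshold x w (backbone x w k) ≠ ⊥ := fun he => by
      have := hle (k + 1) (Nat.lt_succ_self k)
      rw [he] at this
      exact EReal.coe_ne_bot _ (le_bot_iff.1 this)
    rw [← EReal.coe_toReal (h.threshold_lt_top _).ne hbot] at hle ⊢
    rw [EReal.coe_le_coe_iff]
    refine csSup_le ⟨_, k + 1, Nat.lt_succ_self k, rfl⟩ ?_
    rintro _ ⟨i, hi, rfl⟩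
    exact EReal.coe_le_coe_iff.1 (hle i hi)
  · refine iSup_le fun n => thresholdAux_le_of_ray hray k n fun l hl => ?_
    exact EReal.coe_le_coe_iff.2 (le_csSup (h.bddAbove_futureMax k) ⟨l, hl, rfl⟩)

theorem mem_forest {k : ℕ} {y : List ℕ} : y ∈ forest x w k ↔
    y ∈ cluster x w ∧ backbone x w k <:+ y ∧ y ≠ backbone x w k ∧ ¬ backbone x w (k + 1) <:+ y := by
  cases k with
  | zero =>
    simp only [forest, cut, Set.mem_sdiff, Set.mem_ofPred_eq, Set.mem_singleton_iff,
      h.isBackbone_backbone.1, List.nil_suffix, true_and]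
    tauto
  | succ k =>
    simp only [forest, cut, Set.mem_sdiff, Set.mem_ofPred_eq, Set.mem_singleton_iff]
    tauto

theorem finite_forest (k : ℕ) : (forest x w k).Finite := by
  obtain ⟨j, hj, hm⟩ := h.isBackbone_backbone.isMinChild h k
  refine (h.finite_cluster_off hm).subset fun y hy => ?_
  rw [h.mem_forest, hj] at hy
  exact ⟨hy.1, hy.2.1, hy.2.2.2⟩

theorem finite_cut (k : ℕ) : (cut x w k).Finite := by
  induction k with
  | zero =>
    refine ((h.finite_forest 0).union (Set.finite_singleton (backbone x w 0))).subset fun y hy => ?_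
    by_cases hy' : y = backbone x w 0
    · exact Or.inr hy'
    · exact Or.inl ⟨hy, hy'⟩
  | succ k ih =>
    refine (((h.finite_forest (k + 1)).union ih).union
      (Set.finite_singleton (backbone x w (k + 1)))).subset fun y hy => ?_
    by_cases hy' : y = backbone x w (k + 1)
    · exact Or.inr hy'
    · by_cases hy'' : y ∈ cut x w k
      · exact Or.inl (Or.inr hy'')
      · exact Or.inl (Or.inl ⟨⟨hy, hy''⟩, hy'⟩)

/-- The edges of the next cut split disjointly into those of the previous cut, the forest and one
backbone edge. Finiteness of the pieces is needed for `finsum` to be additive. -/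
theorem attachedWeight_eq (k : ℕ) : attachedWeight x w k = ∑ᶠ v ∈ forest x w k, w v := by
  have hb := h.isBackbone_backbone
  cases k with
  | zero => rw [attachedWeight, cutWeight, forest, hb.1]
  | succ k =>
    have hne : backbone x w (k + 1) ≠ [] := fun he => by
      have := hb.length_eq (k + 1)
      rw [he] at this
      simp at this
    have hunion : cut x w (k + 1) \ {[]} =
        (cut x w k \ {[]}) ∪ (forest x w (k + 1) ∪ {backbone x w (k + 1)}) := by
      ext y
      have hsuff : backbone x w (k + 1) <:+ backbone x w (k + 1 + 1) := hb.suffix (Nat.le_succ _)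
      have h1 : backbone x w (k + 1 + 1) <:+ y → backbone x w (k + 1) <:+ y := hsuff.trans
      have h2 : backbone x w (k + 1) <:+ y → y ≠ [] := by
        rintro h rfl
        exact hne (List.suffix_nil.1 h)
      have h3 : y = backbone x w (k + 1) → y ∈ cluster x w ∧ backbone x w (k + 1) <:+ y ∧
          ¬ backbone x w (k + 1 + 1) <:+ y := by
        rintro rfl
        refine ⟨hb.2.2 _, List.suffix_refl _, fun hs => ?_⟩
        have := hs.length_le
        rw [hb.length_eq, hb.length_eq] at this
        omega
      simp only [Set.mem_union, h.mem_forest, cut, Set.mem_sdiff, Set.mem_ofPred_eq,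
        Set.mem_singleton_iff]
      tauto
    have hd1 : Disjoint (cut x w k \ {[]}) (forest x w (k + 1) ∪ {backbone x w (k + 1)}) := by
      refine Set.disjoint_left.2 fun y hy hy' => ?_
      rcases hy' with hy' | rfl
      · exact hy.1.2 (h.mem_forest.1 hy').2.1
      · exact hy.1.2 (List.suffix_refl _)
    have hd2 : Disjoint (forest x w (k + 1)) {backbone x w (k + 1)} := by
      refine Set.disjoint_right.2 ?_
      rintro y rfl hy
      exact (h.mem_forest.1 hy).2.2.1 rfl
    rw [attachedWeight, cutWeight, cutWeight, hunion,
      finsum_mem_union hd1 ((h.finite_cut k).sdiff) ((h.finite_forest _).union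
        (Set.finite_singleton _)),
      finsum_mem_union hd2 (h.finite_forest _) (Set.finite_singleton _), finsum_mem_singleton]
    ring

end IsRegular

end

section

variable {x : List ℕ → ℕ} {w w' : List ℕ → ℝ} {u : List ℕ} {j : ℕ} {F : Finset (List ℕ)}

/-! ### A local description of the forest off the backbone -/

/-- `F` is a set of proper descendants of `u`, not below `j :: u`, that consists of the vertices
which are joined to `u` by edges of weight less than the threshold of the branch of `j :: u`, and
the remaining edges at `F` and at `u` exceed this threshold. -/
structure IsOffspringForest (x : List ℕ → ℕ) (w : List ℕ → ℝ) (u : List ℕ) (j : ℕ)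
    (F : Finset (List ℕ)) : Prop where
  child_lt : j < x u
  nil_notMem : [] ∉ F
  child_notMem : j :: u ∉ F
  parent : ∀ i z, i :: z ∈ F → (z = u ∨ z ∈ F) ∧ i < x z
  inner : ∀ y ∈ F, (w y : EReal) < branchThreshold x w (j :: u)
  outer : ∀ i z, (z = u ∨ z ∈ F) → i < x z → i :: z ∉ F → i :: z ≠ j :: u →
    branchThreshold x w (j :: u) < w (i :: z)

namespace IsOffspringForest

theorem mem_spec (h : IsOffspringForest x w u j F) {y : List ℕ} (hy : y ∈ F) :
    u <:+ y ∧ y ≠ u ∧ ¬ j :: u <:+ y := by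
  induction y with
  | nil => exact absurd hy h.nil_notMem
  | cons i z ih =>
    have hs : u <:+ z ∧ ¬ j :: u <:+ z := by
      rcases (h.parent i z hy).1 with rfl | hz
      · refine ⟨List.suffix_refl _, fun hs => ?_⟩
        have := hs.length_le
        simp at this
      · exact ⟨(ih hz).1, (ih hz).2.2⟩
    refine ⟨hs.1.trans (List.suffix_cons i z), ne_of_suffix_of_cons_suffix hs.1, fun h' => ?_⟩
    rcases List.suffix_cons_iff.1 h' with he | he
    · exact h.child_notMem (he ▸ hy)
    · exact hs.2 he

theorem mem_treeVertices (h : IsOffspringForest x w u j F) (hu : u ∈ treeVertices x) {y : List ℕ}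
    (hy : y ∈ F) : y ∈ treeVertices x := by
  induction y with
  | nil => exact nil_mem_treeVertices
  | cons i z ih =>
    rw [cons_mem_treeVertices]
    obtain ⟨rfl | hz, hi⟩ := h.parent i z hy
    · exact ⟨hu, hi⟩
    · exact ⟨ih hz, hi⟩

theorem mem_of_suffix (h : IsOffspringForest x w u j F) {y z : List ℕ} (hy : y ∈ F)
    (hz : u <:+ z) (hzu : z ≠ u) (hzy : z <:+ y) : z ∈ F := by
  induction y with
  | nil => rwa [List.suffix_nil.1 hzy]
  | cons i y ih =>
    rcases List.suffix_cons_iff.1 hzy with rfl | h'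
    · exact hy
    · rcases (h.parent i y hy).1 with rfl | hy'
      · exact absurd (h'.eq_of_length (le_antisymm h'.length_le hz.length_le)) hzu
      · exact ih hy' h'

/-- If `i :: u` lies outside `F`, its edge is already too heavy. If it lies in `F`, a long path
within the level of `j` would have to leave the finite set `F`, through an edge that exceeds this
level. -/
theorem lt_branchThreshold (h : IsOffspringForest x w u j F) (hu : u ∈ treeVertices x)
    (htop : branchThreshold x w (j :: u) < ⊤) {i : ℕ} (hi : i < x u) (hij : i ≠ j) :
    branchThreshold x w (j :: u) < branchThreshold x w (i :: u) := by
  by_cases hiF : i :: u ∈ F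
  swap
  · exact lt_max_of_lt_left (h.outer i u (Or.inl rfl) hi hiF (by simpa using hij))
  refine lt_max_of_lt_right ?_
  by_contra! hle
  obtain ⟨L, hL⟩ := (F.finite_toSet.image List.length).bddAbove
  obtain ⟨y, hy, hs, hl, hz⟩ := exists_path_of_thresholdAux_le htop (L + 1)
    ((thresholdAux_le_threshold _ _).trans hle) (h.mem_treeVertices hu hiF)
  have hyn : y ∉ (F : Set (List ℕ)) := fun h => by
    have := hL ⟨y, h, rfl⟩
    omega
  obtain ⟨i', z, h1, h2, h3, h4⟩ := exists_exit (S := (F : Set (List ℕ))) hiF hyn hs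
  have hout := h.outer i' z (Or.inr h3)
    (cons_mem_treeVertices.1 (mem_treeVertices_of_suffix hy h1)).2 h4 fun he => by
      rw [(List.cons.inj he).2] at h3
      exact (h.mem_spec h3).2.1 rfl
  exact not_le.2 hout (hz _ (h2.trans (List.suffix_cons i' z)) h1 (ne_of_suffix_of_cons_suffix h2))

theorem isMinChild (h : IsOffspringForest x w u j F) (hu : u ∈ treeVertices x)
    (htop : branchThreshold x w (j :: u) < ⊤) : IsMinChild x w u j :=
  ⟨h.child_lt, fun _ hi hij => h.lt_branchThreshold hu htop hi hij⟩

theorem branchThreshold_eq (h : IsOffspringForest x w u j F) (hw : ∀ y ∉ F, w y = w' y) :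
    branchThreshold x w (j :: u) = branchThreshold x w' (j :: u) :=
  branchThreshold_congr (fun _ _ => rfl) fun y hy => hw y fun hyF => (h.mem_spec hyF).2.2 hy

theorem resample (h : IsOffspringForest x w u j F) (hw : ∀ y ∉ F, w y = w' y)
    (hF : ∀ y ∈ F, (w' y : EReal) < branchThreshold x w (j :: u)) :
    IsOffspringForest x w' u j F where
  child_lt := h.child_lt
  nil_notMem := h.nil_notMem
  child_notMem := h.child_notMem
  parent := h.parent
  inner := by rwa [← h.branchThreshold_eq hw]
  outer i z h1 h2 h3 h4 := by
    rw [← h.branchThreshold_eq hw, ← hw _ h3]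
    exact h.outer i z h1 h2 h3 h4

end IsOffspringForest

/-! ### Invariance under resampling, and agreement with the invasion cluster -/

theorem IsSelected.mem_treeVertices (h : IsSelected x w u) : u ∈ treeVertices x :=
  fun i z hz => (h i z hz).1

/-- The vertex `u` is selected, and so is its child `j :: u`, with off-backbone forest `F`. -/
def IsLocalForest (x : List ℕ → ℕ) (w : List ℕ → ℝ) (u : List ℕ) (j : ℕ)
    (F : Finset (List ℕ)) : Prop :=
  IsSelected x w u ∧ IsOffspringForest x w u j F

/-- The delicate part is that `u` stays selected, although `F` lies in the subtree of every ancestor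
of `u`. The threshold of `u` is the branch threshold of `j :: u` for both weightings, so the change
below `u` is invisible to all ancestors. -/
theorem IsLocalForest.resample (h : IsLocalForest x w u j F) (hw : ∀ y ∉ F, w y = w' y)
    (hF : ∀ y ∈ F, (w' y : EReal) < branchThreshold x w (j :: u))
    (htop : branchThreshold x w (j :: u) < ⊤) : IsLocalForest x w' u j F := by
  obtain ⟨hsel, hfor⟩ := h
  have hfor' := hfor.resample hw hF
  have hu := hsel.mem_treeVertices
  have hbr := hfor.branchThreshold_eq hw
  -- Branches that leave the path to `u` contain no descendant of `u`, hence do not meet `F`.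
  have hbranch : ∀ i z, i :: z <:+ u → ∀ i', i' ≠ i →
      branchThreshold x w (i' :: z) = branchThreshold x w' (i' :: z) := by
    intro i z hz i' hne
    refine branchThreshold_congr (fun _ _ => rfl) fun y hy => hw y fun hyF => ?_
    have h1 : i :: z <:+ y := hz.trans (hfor.mem_spec hyF).1
    have h2 := (List.suffix_of_suffix_length_le hy h1 (by simp)).eq_of_length (by simp)
    exact hne (List.cons.inj h2).1
  -- Induction on the distance `n` from the ancestor `s` to `u`, starting at `u` itself.
  have hthr : ∀ n s, s <:+ u → u.length = s.length + n → threshold x w s = threshold x w' s := by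
    intro n
    induction n with
    | zero =>
      intro s hs hl
      rw [hs.eq_of_length (by omega), (hfor.isMinChild hu htop).threshold_eq,
        (hfor'.isMinChild hu (hbr ▸ htop)).threshold_eq, hbr]
    | succ n ih =>
      intro s hs hl
      obtain ⟨i, hi⟩ := exists_cons_suffix hs (by rintro rfl; omega)
      rw [threshold_eq_inf, threshold_eq_inf]
      refine Finset.inf_congr rfl fun i' _ => ?_
      by_cases hii : i' = i
      · rw [hii, branchThreshold, branchThreshold, ih _ hi (by simp; omega), hw]
        intro hF'
        have h1 := hfor.mem_spec hF'
        exact h1.2.1 (hi.eq_of_length (le_antisymm hi.length_le h1.1.length_le))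
      · exact hbranch i s hi i' hii
  refine ⟨fun i z hz => ?_, hfor'⟩
  have h0 : branchThreshold x w (i :: z) = branchThreshold x w' (i :: z) := by
    rw [branchThreshold, branchThreshold,
      hthr (u.length - (i :: z).length) _ hz (by have := hz.length_le; omega), hw]
    intro hF'
    have h1 := hfor.mem_spec hF'
    exact h1.2.1 (hz.eq_of_length (le_antisymm hz.length_le h1.1.length_le))
  refine ⟨(hsel i z hz).1, fun i' hi' hne => ?_⟩
  rw [← h0, ← hbranch i z hz i' hne]
  exact (hsel i z hz).2 i' hi' hne

namespace IsRegular

variable (h : IsRegular x w)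
include h

theorem exists_backbone_gt {k : ℕ} {p : EReal} (hp : p < threshold x w (backbone x w k)) :
    ∃ l, k < l ∧ p < w (backbone x w l) := by
  by_contra! hcon
  refine not_le.2 hp (iSup_le fun n => thresholdAux_le_of_ray ?_ k n fun l hl => hcon l hl)
  intro k
  obtain ⟨i, hi, hm⟩ := h.isBackbone_backbone.isMinChild h k
  exact ⟨i, hm.1, hi⟩

/-- The heaviest edge on the finite path to `y` is still strictly below the threshold, hence lighter
than some later backbone edge; before that edge is taken, the whole path must have been invaded. -/
theorem mem_cluster_of_lt_threshold {k : ℕ} {y : List ℕ} (hy : y ∈ treeVertices x)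
    (hs : backbone x w k <:+ y) (hlt : ∀ z, backbone x w k <:+ z → z <:+ y → z ≠ backbone x w k →
      (w z : EReal) < threshold x w (backbone x w k)) : y ∈ cluster x w := by
  classical
  have hb := h.isBackbone_backbone
  let A : Finset (List ℕ) := y.tails.toFinset.filter
    fun z => backbone x w k <:+ z ∧ z ≠ backbone x w k
  -- Needed because `A` may be empty, in which case its supremum is `⊥`.
  have hbot : ⊥ < threshold x w (backbone x w k) := by
    rw [← h.coe_futureMax]
    exact EReal.bot_lt_coe _
  have hA : (A.sup fun z => (w z : EReal)) < threshold x w (backbone x w k) := by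
    rw [Finset.sup_lt_iff hbot]
    intro z hz
    simp only [A, Finset.mem_filter, List.mem_toFinset, List.mem_tails] at hz
    exact hlt z hz.2.1 hz.1 hz.2.2
  obtain ⟨l, hl, hlA⟩ := h.exists_backbone_gt hA
  refine mem_cluster_of_lt (hb.2.2 l) (hb.suffix hl.le) (fun he => ?_) hy hs fun z h1 h2 h3 => ?_
  · have := congrArg List.length he
    rw [hb.length_eq, hb.length_eq] at this
    omega
  · refine EReal.coe_lt_coe_iff.1 (lt_of_le_of_lt ?_ hlA)
    refine Finset.le_sup (f := fun z => (w z : EReal)) ?_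
    simp only [A, Finset.mem_filter, List.mem_toFinset, List.mem_tails]
    exact ⟨h2, h1, h3⟩

theorem backbone_eq_of_isLocalForest (hF : IsLocalForest x w u j F) :
    backbone x w u.length = u ∧ backbone x w (u.length + 1) = j :: u :=
  ⟨h.backbone_eq hF.1, h.backbone_eq (isSelected_cons.2 ⟨hF.1,
    hF.2.isMinChild hF.1.mem_treeVertices (h.branchThreshold_lt_top _)⟩)⟩

theorem coe_futureMax_of_isLocalForest (hF : IsLocalForest x w u j F) :
    (futureMax x w u.length : EReal) = branchThreshold x w (j :: u) := by
  rw [h.coe_futureMax, (h.backbone_eq_of_isLocalForest hF).1,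
    (hF.2.isMinChild hF.1.mem_treeVertices (h.branchThreshold_lt_top _)).threshold_eq]

/-- Leaving `F` off the backbone needs an edge above the threshold of `u`, which is never invaded
below `u`; the edges inside `F` lie strictly below it, so all of `F` is invaded. -/
theorem forest_eq_of_isLocalForest (hF : IsLocalForest x w u j F) :
    forest x w u.length = F := by
  obtain ⟨hb, hb'⟩ := h.backbone_eq_of_isLocalForest hF
  have hu := hF.1.mem_treeVertices
  have hthr := (hF.2.isMinChild hu (h.branchThreshold_lt_top _)).threshold_eq
  ext y
  rw [h.mem_forest, hb, hb']
  constructor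
  · rintro ⟨h1, h2, h3, h4⟩
    induction y with
    | nil => exact absurd (List.suffix_nil.1 h2).symm h3
    | cons i z ih =>
      by_contra hyF
      have hz : z = u ∨ z ∈ F := by
        by_cases hzu : z = u
        · exact Or.inl hzu
        · refine Or.inr (ih (parent_mem_cluster h1) ?_ hzu fun h' =>
            h4 (h'.trans (List.suffix_cons i z)))
          rcases List.suffix_cons_iff.1 h2 with h' | h'
          · exact absurd h'.symm h3
          · exact h'
      have hi := (cons_mem_treeVertices.1 (cluster_subset_treeVertices h1)).2
      have hout := hF.2.outer i z hz hi hyF fun he => h4 (he ▸ List.suffix_refl _)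
      rw [← hthr] at hout
      exact not_le.2 hout (weight_le_threshold (h.threshold_lt_top _) h1 h2 h3)
  · intro hy
    have hspec := hF.2.mem_spec hy
    refine ⟨?_, hspec⟩
    refine h.mem_cluster_of_lt_threshold (k := u.length) (hF.2.mem_treeVertices hu hy)
      (hb.symm ▸ hspec.1) ?_
    rw [hb]
    intro z h1 h2 h3
    rw [hthr]
    exact hF.2.inner z (hF.2.mem_of_suffix hy h1 h3 h2)

theorem exists_isLocalForest {k : ℕ} (hF : forest x w k = F) :
    ∃ u j, u.length = k ∧ IsLocalForest x w u j F := by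
  have hb := h.isBackbone_backbone
  obtain ⟨j, hj, hm⟩ := hb.isMinChild h k
  set u := backbone x w k with hu
  have hthr := hm.threshold_eq
  have hmem : ∀ y, y ∈ F ↔ y ∈ cluster x w ∧ u <:+ y ∧ y ≠ u ∧ ¬ j :: u <:+ y := by
    intro y
    rw [← Finset.mem_coe, ← hF, h.mem_forest, hj]
  -- Regularity excludes ties with either term of the maximum defining the branch threshold; this
  -- makes the inner and outer inequalities strict.
  have hne : ∀ y, ¬ j :: u <:+ y → (w y : EReal) ≠ branchThreshold x w (j :: u) := by
    intro y hy he
    rcases max_choice (w (j :: u) : EReal) (threshold x w (j :: u)) with h' | h'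
    · rw [branchThreshold, h', EReal.coe_eq_coe_iff] at he
      exact hy (h.injective he ▸ List.suffix_refl _)
    · rw [branchThreshold, h'] at he
      exact h.threshold_ne y _ hy he.symm
  have hinner : ∀ y ∈ F, (w y : EReal) < branchThreshold x w (j :: u) := by
    intro y hy
    have hy' := (hmem y).1 hy
    refine lt_of_le_of_ne ?_ (hne y hy'.2.2.2)
    rw [← hthr]
    exact weight_le_threshold (h.threshold_lt_top _) hy'.1 hy'.2.1 hy'.2.2.1
  have hnot : ∀ i z, (z = u ∨ z ∈ F) → i :: z ≠ j :: u → ¬ j :: u <:+ i :: z := by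
    intro i z hz hne hs
    rcases List.suffix_cons_iff.1 hs with h' | h'
    · exact hne h'.symm
    · rcases hz with rfl | hz
      · have := h'.length_le
        simp at this
      · exact ((hmem z).1 hz).2.2.2 h'
  refine ⟨u, j, hb.length_eq k, hb.isSelected h k, hm.1, fun h0 => ?_, fun h0 => ?_, ?_, hinner, ?_⟩
  · have := (hmem _).1 h0
    exact this.2.2.1 (List.suffix_nil.1 this.2.1).symm
  · exact ((hmem _).1 h0).2.2.2 (List.suffix_refl _)
  · intro i z hz
    have hz' := (hmem _).1 hz
    refine ⟨?_, (cons_mem_treeVertices.1 (cluster_subset_treeVertices hz'.1)).2⟩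
    by_cases hzu : z = u
    · exact Or.inl hzu
    · refine Or.inr ((hmem z).2 ⟨parent_mem_cluster hz'.1, ?_, hzu, fun h' =>
        hz'.2.2.2 (h'.trans (List.suffix_cons i z))⟩)
      rcases List.suffix_cons_iff.1 hz'.2.1 with h' | h'
      · exact absurd h'.symm hz'.2.2.1
      · exact h'
  · intro i z hz hi hF' hne'
    by_contra! hle
    have hnj := hnot i z hz hne'
    have hlt := lt_of_le_of_ne hle (hne _ hnj)
    have huz : u <:+ z := by
      rcases hz with rfl | hz
      · exact List.suffix_refl _
      · exact ((hmem z).1 hz).2.1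
    have hzT : z ∈ cluster x w := by
      rcases hz with rfl | hz
      · exact hb.2.2 k
      · exact ((hmem z).1 hz).1
    refine hF' ((hmem _).2 ⟨?_, huz.trans (List.suffix_cons i z), ne_of_suffix_of_cons_suffix huz,
      hnj⟩)
    refine h.mem_cluster_of_lt_threshold (k := k)
      (cons_mem_treeVertices.2 ⟨cluster_subset_treeVertices hzT, hi⟩)
      (huz.trans (List.suffix_cons i z)) fun z' h1 h2 h3 => ?_
    rw [← hu, hthr]
    rcases List.suffix_cons_iff.1 h2 with rfl | h4
    · exact hlt
    · rcases hz with rfl | hz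
      · exact absurd (h4.eq_of_length (le_antisymm h4.length_le h1.length_le)) h3
      · refine hinner z' ((hmem z').2 ⟨mem_cluster_of_suffix h4 hzT, h1, h3, fun h' => ?_⟩)
        exact ((hmem z).1 hz).2.2.2 (h'.trans h4)

theorem forest_eq_iff {k : ℕ} :
    forest x w k = F ↔ ∃ u j, u.length = k ∧ IsLocalForest x w u j F :=
  ⟨h.exists_isLocalForest, by rintro ⟨u, j, rfl, hF⟩; exact h.forest_eq_of_isLocalForest hF⟩

end IsRegular

end

/-! ### Measurability in the configuration -/

theorem measurable_inf_range {β : Type*} [MeasurableSpace β] {N : β → ℕ} {f : ℕ → β → EReal}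
    (hN : Measurable N) (hf : ∀ i, Measurable (f i)) :
    Measurable fun b => (Finset.range (N b)).inf fun i => f i b := by
  have h : Measurable fun q : ℕ × β => (Finset.range q.1).inf fun i => f i q.2 := by
    refine measurable_from_prod_countable_right fun n => ?_
    induction n with
    | zero => simp
    | succ n ih =>
      simp only [Finset.range_add_one, Finset.inf_insert]
      exact (hf n).min ih
  exact h.comp (hN.prodMk measurable_id)

theorem measurable_thresholdAux (n : ℕ) (v : List ℕ) :
    Measurable fun c : (List ℕ → ℕ) × (List ℕ → ℝ) => thresholdAux c.1 c.2 n v := by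
  induction n generalizing v with
  | zero => exact measurable_const
  | succ n ih =>
    simp only [thresholdAux]
    refine measurable_inf_range (by fun_prop) fun i => ?_
    exact (measurable_coe_real_ereal.comp (by fun_prop)).max (ih _)

theorem measurable_threshold (v : List ℕ) :
    Measurable fun c : (List ℕ → ℕ) × (List ℕ → ℝ) => threshold c.1 c.2 v :=
  Measurable.iSup fun n => measurable_thresholdAux n v

theorem measurable_branchThreshold (v : List ℕ) :
    Measurable fun c : (List ℕ → ℕ) × (List ℕ → ℝ) => branchThreshold c.1 c.2 v :=
  (measurable_coe_real_ereal.comp (by fun_prop)).max (measurable_threshold v)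

theorem measurableSet_lt_offspring (i : ℕ) (v : List ℕ) :
    MeasurableSet {c : (List ℕ → ℕ) × (List ℕ → ℝ) | i < c.1 v} :=
  measurableSet_lt measurable_const (by fun_prop)

theorem measurableSet_isMinChild (v : List ℕ) (j : ℕ) :
    MeasurableSet {c : (List ℕ → ℕ) × (List ℕ → ℝ) | IsMinChild c.1 c.2 v j} := by
  refine measurableSet_setOfPred.2 (Measurable.and ?_ ?_)
  · exact measurableSet_setOfPred.1 (measurableSet_lt_offspring j v)
  · refine Measurable.forall fun i => Measurable.imp
      (measurableSet_setOfPred.1 (measurableSet_lt_offspring i v)) (Measurable.imp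
        measurable_const ?_)
    exact measurableSet_setOfPred.1
      (measurableSet_lt (measurable_branchThreshold _) (measurable_branchThreshold _))

theorem measurableSet_isSelected (v : List ℕ) :
    MeasurableSet {c : (List ℕ → ℕ) × (List ℕ → ℝ) | IsSelected c.1 c.2 v} := by
  refine measurableSet_setOfPred.2 (Measurable.forall fun i => Measurable.forall fun z =>
    Measurable.imp measurable_const ?_)
  exact measurableSet_setOfPred.1 (measurableSet_isMinChild z i)

theorem measurableSet_isLocalForest (u : List ℕ) (j : ℕ) (F : Finset (List ℕ)) :
    MeasurableSet {c : (List ℕ → ℕ) × (List ℕ → ℝ) | IsLocalForest c.1 c.2 u j F} := by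
  have hw : ∀ y, Measurable fun c : (List ℕ → ℕ) × (List ℕ → ℝ) => (c.2 y : EReal) :=
    fun y => measurable_coe_real_ereal.comp (by fun_prop)
  have hx : ∀ i z, Measurable fun c : (List ℕ → ℕ) × (List ℕ → ℝ) => i < c.1 z :=
    fun i z => measurableSet_setOfPred.1 (measurableSet_lt_offspring i z)
  have hset : {c : (List ℕ → ℕ) × (List ℕ → ℝ) | IsLocalForest c.1 c.2 u j F} =
      {c | IsSelected c.1 c.2 u ∧ j < c.1 u ∧ [] ∉ F ∧ j :: u ∉ F ∧
        (∀ i z, i :: z ∈ F → (z = u ∨ z ∈ F) ∧ i < c.1 z) ∧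
        (∀ y, y ∈ F → (c.2 y : EReal) < branchThreshold c.1 c.2 (j :: u)) ∧
        (∀ i z, (z = u ∨ z ∈ F) → i < c.1 z → i :: z ∉ F → i :: z ≠ j :: u →
          branchThreshold c.1 c.2 (j :: u) < c.2 (i :: z))} := by
    ext c
    exact ⟨fun h => ⟨h.1, h.2.1, h.2.2, h.2.3, h.2.4, h.2.5, h.2.6⟩,
      fun h => ⟨h.1, h.2.1, h.2.2.1, h.2.2.2.1, h.2.2.2.2.1, h.2.2.2.2.2.1, h.2.2.2.2.2.2⟩⟩
  rw [hset]
  refine measurableSet_setOfPred.2 (Measurable.and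
    (measurableSet_setOfPred.1 (measurableSet_isSelected u)) ((hx j u).and
      (measurable_const.and (measurable_const.and (Measurable.and ?_ (Measurable.and ?_ ?_))))))
  · exact Measurable.forall fun i => Measurable.forall fun z => Measurable.imp measurable_const
      (measurable_const.and (hx i z))
  · exact Measurable.forall fun y => Measurable.imp measurable_const
      (measurableSet_setOfPred.1 (measurableSet_lt (hw y) (measurable_branchThreshold _)))
  · exact Measurable.forall fun i => Measurable.forall fun z => Measurable.imp measurable_const
      ((hx i z).imp (Measurable.imp measurable_const (Measurable.imp measurable_const
      (measurableSet_setOfPred.1 (measurableSet_lt (measurable_branchThreshold _) (hw _))))))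

/-! ### Independence of parts of the configuration -/

open Classical in
/-- The configuration in which the coordinates outside `S` are replaced by constants; `(v, false)`
stands for the offspring number of `v` and `(v, true)` for the weight of its edge. -/
noncomputable def restrictConfig (S : Set (List ℕ × Bool))
    (c : (List ℕ → ℕ) × (List ℕ → ℝ)) : (List ℕ → ℕ) × (List ℕ → ℝ) :=
  (fun v => if (v, false) ∈ S then c.1 v else 0, fun v => if (v, true) ∈ S then c.2 v else -1)

theorem restrictConfig_fst {S : Set (List ℕ × Bool)} {c : (List ℕ → ℕ) × (List ℕ → ℝ)} {v : List ℕ}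
    (h : (v, false) ∈ S) : (restrictConfig S c).1 v = c.1 v := if_pos h

theorem restrictConfig_snd {S : Set (List ℕ × Bool)} {c : (List ℕ → ℕ) × (List ℕ → ℝ)} {v : List ℕ}
    (h : (v, true) ∈ S) : (restrictConfig S c).2 v = c.2 v := if_pos h

theorem restrictConfig_snd_of_notMem {S : Set (List ℕ × Bool)}
    {c : (List ℕ → ℕ) × (List ℕ → ℝ)} {v : List ℕ}
    (h : (v, true) ∉ S) : (restrictConfig S c).2 v = -1 := if_neg h

/-- The σ-algebra on `Ω` is left free so that the one generated by the coordinates in `S` can be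
used. -/
theorem measurable_restrictConfig {Ω : Type*} {m : MeasurableSpace Ω} {X : Ω → List ℕ → ℕ}
    {U : Ω → List ℕ → ℝ} {S : Set (List ℕ × Bool)}
    (hX : ∀ v, (v, false) ∈ S → Measurable fun ω => X ω v)
    (hU : ∀ v, (v, true) ∈ S → Measurable fun ω => U ω v) :
    Measurable fun ω => restrictConfig S (X ω, U ω) := by
  refine Measurable.prodMk (measurable_pi_lambda _ fun v => ?_) (measurable_pi_lambda _ fun v => ?_)
  · by_cases hv : (v, false) ∈ S
    · simpa [hv] using hX v hv
    · simp [hv]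
  · by_cases hv : (v, true) ∈ S
    · simpa [hv] using hU v hv
    · simp [hv]

instance isProbabilityMeasure_unif_one : IsProbabilityMeasure (unif 1) :=
  cond_isProbabilityMeasure_of_finite (by simp) (by simp)

theorem unif_one_eq : unif 1 = volume.restrict (Set.Icc 0 1) := by
  rw [unif, ProbabilityTheory.cond]
  simp

namespace IsWeightedBPTree

variable {Ω : Type*} [MeasurableSpace Ω] {P : Measure Ω} {ν : Measure ℕ} {X : Ω → List ℕ → ℕ} {U : Ω → List ℕ → ℝ}
  (h : IsWeightedBPTree P ν X U)
include h

theorem measurable_config : Measurable fun ω => (X ω, U ω) :=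
  (measurable_pi_lambda _ h.measurable_offspring).prodMk
    (measurable_pi_lambda _ h.measurable_weight)

theorem map_offspring [SFinite ν] (v : List ℕ) : P.map (fun ω => X ω v) = ν := by
  have := congrArg Measure.fst (h.law v)
  rwa [Measure.fst_map_prodMk (h.measurable_weight v), Measure.fst_prod] at this

theorem map_weight [IsProbabilityMeasure ν] (v : List ℕ) : P.map (fun ω => U ω v) = unif 1 := by
  have := congrArg Measure.snd (h.law v)
  rwa [Measure.snd_map_prodMk (h.measurable_offspring v), Measure.snd_prod] at this

variable [IsProbabilityMeasure P] [IsProbabilityMeasure ν]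

theorem indepFun_offspring_weight (v : List ℕ) :
    IndepFun (fun ω => X ω v) (fun ω => U ω v) P := by
  rw [indepFun_iff_map_prod_eq_prod_map_map (h.measurable_offspring v).aemeasurable
    (h.measurable_weight v).aemeasurable, h.law, h.map_offspring, h.map_weight]

/-- Offspring numbers are cast to reals so that they and the weights form a single family, indexed
by `List ℕ × Bool`, whose disjoint subfamilies can be compared. -/
theorem iIndepFun_coordinates :
    iIndepFun (fun (q : List ℕ × Bool) ω => bif q.2 then U ω q.1 else (X ω q.1 : ℝ)) P := by
  refine iIndepFun_uncurry' (X := fun v b ω => bif b then U ω v else (X ω v : ℝ)) ?_ ?_ ?_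
  · intro v b
    cases b
    · exact (measurable_from_nat (f := fun n : ℕ => (n : ℝ))).comp (h.measurable_offspring v)
    · simpa using h.measurable_weight v
  · refine h.indep.comp (fun _ (q : ℕ × ℝ) (b : Bool) => bif b then q.2 else (q.1 : ℝ)) fun v => ?_
    refine measurable_pi_lambda _ fun b => ?_
    cases b
    · exact (measurable_from_nat (f := fun n : ℕ => (n : ℝ))).comp measurable_fst
    · simpa using measurable_snd
  · intro v
    have h2 : IndepFun (fun ω => U ω v) (fun ω => (X ω v : ℝ)) P :=
      (h.indepFun_offspring_weight v).symm.comp measurable_id measurable_from_nat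
    rw [iIndepFun_iff_measure_inter_preimage_eq_mul]
    intro S sets hsets
    have hS : S = ∅ ∨ S = {true} ∨ S = {false} ∨ S = {true, false} := by
      clear hsets
      decide +revert
    rcases hS with rfl | rfl | rfl | rfl
    · simp
    · simp
    · simp
    · have := h2.measure_inter_preimage_eq_mul _ _ (hsets true (by simp)) (hsets false (by simp))
      rw [Finset.set_biInter_insert, Finset.set_biInter_singleton, Finset.prod_pair (by simp)]
      exact this

/-- Disjoint parts of the configuration are independent. -/
theorem indepFun_restrictConfig {S T : Set (List ℕ × Bool)} (hST : Disjoint S T) :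
    IndepFun (fun ω => restrictConfig S (X ω, U ω)) (fun ω => restrictConfig T (X ω, U ω)) P := by
  let Y : List ℕ × Bool → Ω → ℝ := fun q ω => bif q.2 then U ω q.1 else (X ω q.1 : ℝ)
  have hY : ∀ q, Measurable (Y q) := by
    rintro ⟨v, b⟩
    cases b
    · exact (measurable_from_nat (f := fun n : ℕ => (n : ℝ))).comp (h.measurable_offspring v)
    · simpa [Y] using h.measurable_weight v
  have hind := indep_iSup_of_disjoint (fun q => (hY q).comap_le)
    ((iIndepFun_iff_iIndep _ _ _).1 h.iIndepFun_coordinates) hST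
  have hle : ∀ R : Set (List ℕ × Bool), MeasurableSpace.comap
      (fun ω => restrictConfig R (X ω, U ω)) inferInstance ≤
        ⨆ q ∈ R, MeasurableSpace.comap (Y q) inferInstance := by
    intro R
    have hq : ∀ q ∈ R, Measurable[⨆ q ∈ R, MeasurableSpace.comap (Y q) inferInstance] (Y q) :=
      fun q hq => Measurable.mono (comap_measurable (Y q))
        (le_iSup₂ (f := fun q (_ : q ∈ R) => MeasurableSpace.comap (Y q) inferInstance) q hq) le_rfl
    refine Measurable.comap_le (measurable_restrictConfig (fun v hv => ?_) fun v hv => hq _ hv)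
    -- The floor recovers the offspring number from its real cast.
    simpa [Y, Function.comp_def] using Nat.measurable_floor.comp (hq _ hv)
  exact (IndepFun_iff_Indep _ _ _).2 (indep_of_indep_of_le_left (indep_of_indep_of_le_right hind
    (hle T)) (hle S))

end IsWeightedBPTree

/-! ### Survival probabilities -/

/-- The probability that at least one child is kept when every child is kept independently with
probability `q`. -/
noncomputable def keepProb (ν : Measure ℕ) (q : ℝ) : ℝ := 1 - ∫ n, (1 - q) ^ n ∂ν

section keepProb

variable {ν : Measure ℕ} [IsProbabilityMeasure ν]

theorem integrable_one_sub_pow {q : ℝ} (hq : q ∈ Set.Icc (0 : ℝ) 1) :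
    Integrable (fun n : ℕ => (1 - q) ^ n) ν := by
  refine Integrable.of_bound (C := 1) (measurable_of_countable _).aestronglyMeasurable
    (ae_of_all _ fun n => ?_)
  rw [Real.norm_of_nonneg (pow_nonneg (by linarith [hq.2]) n)]
  exact pow_le_one₀ (by linarith [hq.2]) (by linarith [hq.1])

theorem keepProb_zero : keepProb ν 0 = 0 := by simp [keepProb]

theorem keepProb_mono {q r : ℝ} (hq : q ∈ Set.Icc (0 : ℝ) 1) (hr : r ∈ Set.Icc (0 : ℝ) 1)
    (hqr : q ≤ r) : keepProb ν q ≤ keepProb ν r := by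
  refine sub_le_sub_left (integral_mono (integrable_one_sub_pow hr) (integrable_one_sub_pow hq)
    fun n => ?_) _
  exact pow_le_pow_left₀ (by linarith [hr.2]) (by linarith) n

theorem continuousOn_keepProb : ContinuousOn (keepProb ν) (Set.Icc 0 1) := by
  refine continuousOn_const.sub (continuousOn_of_dominated (bound := fun _ => 1)
    (fun q _ => (measurable_of_countable _).aestronglyMeasurable) (fun q hq => ae_of_all _ fun n => ?_)
    (integrable_const _) (ae_of_all _ fun n => by fun_prop))
  rw [Real.norm_of_nonneg (pow_nonneg (by linarith [hq.2]) n)]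
  exact pow_le_one₀ (by linarith [hq.2]) (by linarith [hq.1])

/-- Strict concavity along the chord from `0`: powers are convex at `1 - r * q = (1 - r) * 1 + r *
(1 - q)`, strictly for exponents at least two, which carry positive mass. -/
theorem mul_keepProb_lt (hν : ν {n | 2 ≤ n} ≠ 0) {q r : ℝ} (hq : 0 < q) (hq1 : q ≤ 1) (hr : 0 < r)
    (hr1 : r < 1) : r * keepProb ν q < keepProb ν (r * q) := by
  have hqI : q ∈ Set.Icc (0 : ℝ) 1 := ⟨hq.le, hq1⟩
  have hrqI : r * q ∈ Set.Icc (0 : ℝ) 1 := ⟨by positivity, by nlinarith⟩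
  have hcomb : 1 - r * q = (1 - r) • (1 : ℝ) + r • (1 - q) := by
    simp only [smul_eq_mul]; ring
  have hnonneg : ∀ n : ℕ, 0 ≤ (1 - r) + r * (1 - q) ^ n - (1 - r * q) ^ n := by
    intro n
    have := (convexOn_pow n).2 (show (1 : ℝ) ∈ Set.Ici 0 by simp)
      (show 1 - q ∈ Set.Ici (0 : ℝ) by simp [hq1]) (by linarith : 0 ≤ 1 - r) hr.le (by ring)
    rw [← hcomb] at this
    simp only [smul_eq_mul, one_pow] at this
    linarith
  have hadd : Integrable (fun n : ℕ => (1 - r) + r * (1 - q) ^ n) ν :=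
    (integrable_const _).add ((integrable_one_sub_pow hqI).const_mul r)
  have hint : Integrable (fun n : ℕ => (1 - r) + r * (1 - q) ^ n - (1 - r * q) ^ n) ν :=
    hadd.sub (integrable_one_sub_pow hrqI)
  have hpos : 0 < ∫ n : ℕ, ((1 - r) + r * (1 - q) ^ n - (1 - r * q) ^ n) ∂ν := by
    rw [integral_pos_iff_support_of_nonneg hnonneg hint]
    refine lt_of_lt_of_le (pos_iff_ne_zero.2 hν) (measure_mono fun n hn => ?_)
    have := (strictConvexOn_pow (n := n) hn).2 (show (1 : ℝ) ∈ Set.Ici 0 by simp)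
      (show 1 - q ∈ Set.Ici (0 : ℝ) by simp [hq1]) (by linarith) (by linarith : 0 < 1 - r) hr
      (by ring)
    rw [← hcomb] at this
    simp only [smul_eq_mul, one_pow] at this
    exact ne_of_gt (by linarith)
  rw [integral_sub hadd (integrable_one_sub_pow hrqI), integral_add (integrable_const _)
      ((integrable_one_sub_pow hqI).const_mul r), integral_const_mul] at hpos
  simp only [integral_const, probReal_univ, one_smul] at hpos
  rw [keepProb, keepProb]
  linarith

end keepProb

/-- The distribution function of the edge weights. -/
noncomputable def weightCDF (p : ℝ) : ℝ := (unif 1).real (Set.Iic p)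

theorem weightCDF_eq (p : ℝ) : weightCDF p = max 0 (min p 1) := by
  rw [weightCDF, unif_one_eq, measureReal_restrict_apply measurableSet_Iic]
  have : Set.Iic p ∩ Set.Icc 0 1 = Set.Icc 0 (min p 1) := by
    ext y
    simp only [Set.mem_inter_iff, Set.mem_Iic, Set.mem_Icc, le_min_iff]
    tauto
  rw [this, Real.volume_real_Icc, sub_zero, max_comm]

theorem weightCDF_mem_Icc (p : ℝ) : weightCDF p ∈ Set.Icc (0 : ℝ) 1 :=
  ⟨measureReal_nonneg, measureReal_le_one⟩

theorem continuous_weightCDF : Continuous weightCDF := by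
  rw [funext weightCDF_eq]
  fun_prop

theorem unif_one_singleton (p : ℝ) : unif 1 {p} = 0 := by
  rw [unif_one_eq]
  exact Measure.restrict_apply_eq_zero' (measurableSet_Icc) |>.2
    (measure_mono_null Set.inter_subset_left (by simp))

/-- By Fubini, the diagonal is null for a product measure with one atomless factor. -/
theorem ae_ne_of_indepFun {Ω β : Type*} [MeasurableSpace Ω] {P : Measure Ω} [IsFiniteMeasure P]
    [MeasurableSpace β] [MeasurableEq β] {f g : Ω → β} (hf : Measurable f) (hg : Measurable g)
    (h : IndepFun f g P) (hatom : ∀ b, P (f ⁻¹' {b}) = 0) : ∀ᵐ ω ∂P, f ω ≠ g ω := by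
  have hd : MeasurableSet {q : β × β | q.2 = q.1} := measurableSet_eq_fun measurable_snd measurable_fst
  have h1 : (P.map g).prod (P.map f) {q : β × β | q.2 = q.1} = 0 := by
    rw [Measure.measure_prod_null hd]
    refine ae_of_all _ fun b => ?_
    have hb : MeasurableSet {b} := by
      have : ({b} : Set β) = (fun a => (b, a)) ⁻¹' {q : β × β | q.2 = q.1} := by ext; simp
      rw [this]
      exact measurable_prodMk_left hd
    have : Prod.mk b ⁻¹' {q : β × β | q.2 = q.1} = {b} := by ext; simp
    simp only [this, Measure.map_apply hf hb]
    exact hatom b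
  rw [← (indepFun_iff_map_prod_eq_prod_map_map hg.aemeasurable hf.aemeasurable).1 h.symm,
    Measure.map_apply (hg.prodMk hf) hd] at h1
  exact measure_eq_zero_iff_ae_notMem.1 h1

/-! ### Dependence on subtrees, and the distribution of thresholds -/

theorem thresholdAux_restrictConfig {S : Set (List ℕ × Bool)} {v : List ℕ}
    (hX : ∀ y, v <:+ y → (y, false) ∈ S) (hU : ∀ y, v <:+ y → y ≠ v → (y, true) ∈ S) (n : ℕ)
    (c : (List ℕ → ℕ) × (List ℕ → ℝ)) :
    thresholdAux (restrictConfig S c).1 (restrictConfig S c).2 n v = thresholdAux c.1 c.2 n v :=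
  thresholdAux_congr n (fun y hy => restrictConfig_fst (hX y hy))
    fun y hy hne => restrictConfig_snd (hU y hy hne)

theorem threshold_restrictConfig {S : Set (List ℕ × Bool)} {v : List ℕ}
    (hX : ∀ y, v <:+ y → (y, false) ∈ S) (hU : ∀ y, v <:+ y → y ≠ v → (y, true) ∈ S)
    (c : (List ℕ → ℕ) × (List ℕ → ℝ)) :
    threshold (restrictConfig S c).1 (restrictConfig S c).2 v = threshold c.1 c.2 v :=
  iSup_congr fun n => thresholdAux_restrictConfig hX hU n c

theorem branchThreshold_restrictConfig {S : Set (List ℕ × Bool)} {v : List ℕ}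
    (hS : ∀ y b, v <:+ y → (y, b) ∈ S) (c : (List ℕ → ℕ) × (List ℕ → ℝ)) :
    branchThreshold (restrictConfig S c).1 (restrictConfig S c).2 v = branchThreshold c.1 c.2 v :=
  branchThreshold_congr (fun y hy => restrictConfig_fst (hS y _ hy))
    fun y hy => restrictConfig_snd (hS y _ hy)

theorem not_suffix_of_cons_suffix {i j : ℕ} {v y : List ℕ} (hij : i ≠ j) (hi : i :: v <:+ y) :
    ¬ j :: v <:+ y := by
  intro hj
  have := (List.suffix_of_suffix_length_le hi hj (by simp)).eq_of_length (by simp)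
  exact hij (List.cons.inj this).1

namespace IsWeightedBPTree

variable {Ω : Type*} [MeasurableSpace Ω] {P : Measure Ω} [IsProbabilityMeasure P]
  {ν : Measure ℕ} {X : Ω → List ℕ → ℕ} {U : Ω → List ℕ → ℝ}
  (h : IsWeightedBPTree P ν X U)
include h

theorem tendsto_measureReal_thresholdAux (v : List ℕ) (p : ℝ) :
    Tendsto (fun n => P.real {ω | thresholdAux (X ω) (U ω) n v ≤ p}) atTop
      (𝓝 (P.real {ω | threshold (X ω) (U ω) v ≤ p})) := by
  have hset : {ω | threshold (X ω) (U ω) v ≤ p} =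
      ⋂ n, {ω | thresholdAux (X ω) (U ω) n v ≤ p} := by
    ext ω
    simp [threshold]
  rw [hset]
  refine (ENNReal.tendsto_toReal (measure_ne_top _ _)).comp (tendsto_measure_iInter_atTop
    (fun n => (measurableSet_le ((measurable_thresholdAux n v).comp h.measurable_config)
      measurable_const).nullMeasurableSet) ?_ ⟨0, measure_ne_top _ _⟩)
  intro m n hmn ω hω
  exact (thresholdAux_mono v hmn).trans hω

variable [IsProbabilityMeasure ν]

theorem measureReal_lt_max (n : ℕ) (v : List ℕ) (p : ℝ) :
    P.real {ω | (p : EReal) < max (U ω v : EReal) (thresholdAux (X ω) (U ω) n v)} =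
      1 - weightCDF p * P.real {ω | thresholdAux (X ω) (U ω) n v ≤ p} := by
  have hmeas : MeasurableSet {ω | thresholdAux (X ω) (U ω) n v ≤ p} :=
    measurableSet_le ((measurable_thresholdAux n v).comp h.measurable_config) measurable_const
  have hU : MeasurableSet {ω | U ω v ≤ p} :=
    measurableSet_le (h.measurable_weight v) measurable_const
  have hset : {ω | (p : EReal) < max (U ω v : EReal) (thresholdAux (X ω) (U ω) n v)} =
      ({ω | U ω v ≤ p} ∩ {ω | thresholdAux (X ω) (U ω) n v ≤ p})ᶜ := by
    ext ω
    simp only [Set.mem_ofPred_eq, Set.mem_compl_iff, Set.mem_inter_iff, not_and_or, not_le,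
      lt_max_iff, EReal.coe_lt_coe_iff]
  have hind := h.indepFun_restrictConfig (S := {(v, true)}) (T := {(v, true)}ᶜ)
    disjoint_compl_right
  have hmul := hind.measure_inter_preimage_eq_mul {c | c.2 v ≤ p}
    {c | thresholdAux c.1 c.2 n v ≤ p} (measurableSet_le (by fun_prop) measurable_const)
    (measurableSet_le (measurable_thresholdAux n v) measurable_const)
  have h1 : (fun ω => restrictConfig {(v, true)} (X ω, U ω)) ⁻¹' {c | c.2 v ≤ p} =
      {ω | U ω v ≤ p} := by
    ext ω
    simp only [Set.mem_preimage, Set.mem_ofPred_eq]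
    rw [restrictConfig_snd (Set.mem_singleton _)]
  have h2 : (fun ω => restrictConfig {(v, true)}ᶜ (X ω, U ω)) ⁻¹'
      {c | thresholdAux c.1 c.2 n v ≤ p} = {ω | thresholdAux (X ω) (U ω) n v ≤ p} := by
    ext ω
    simp only [Set.mem_preimage, Set.mem_ofPred_eq]
    rw [thresholdAux_restrictConfig (fun y _ => by simp) (fun y _ hne => by simpa using hne)]
  rw [h1, h2] at hmul
  rw [hset, probReal_compl_eq_one_sub (hU.inter hmeas), measureReal_def, hmul, ENNReal.toReal_mul,
    weightCDF, ← h.map_weight v, measureReal_def, measureReal_def,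
    Measure.map_apply (h.measurable_weight v) measurableSet_Iic]
  rfl

/-- The offspring number `N` and the number `M` of inspected branches are kept separate, so that
branches can be split off one at a time; the case `M = N` is the one of interest. -/
theorem measureReal_children (v : List ℕ) (n N M : ℕ) (p s : ℝ)
    (hs : ∀ i, P.real {ω | (p : EReal) <
      max (U ω (i :: v) : EReal) (thresholdAux (X ω) (U ω) n (i :: v))} = s) :
    P.real {ω | X ω v = N ∧ ∀ i < M, (p : EReal) <
      max (U ω (i :: v) : EReal) (thresholdAux (X ω) (U ω) n (i :: v))} = ν.real {N} * s ^ M := by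
  induction M with
  | zero =>
    simp only [not_lt_zero, IsEmpty.forall_iff, implies_true, and_true, pow_zero, mul_one]
    rw [← h.map_offspring v, measureReal_def, measureReal_def,
      Measure.map_apply (h.measurable_offspring v) (measurableSet_singleton N)]
    rfl
  | succ M ih =>
    let S : Set (List ℕ × Bool) := {q | ¬ M :: v <:+ q.1}
    have hind := h.indepFun_restrictConfig (S := S) (T := Sᶜ) disjoint_compl_right
    have hm : ∀ i, MeasurableSet {c : (List ℕ → ℕ) × (List ℕ → ℝ) | (p : EReal) <
        max (c.2 (i :: v) : EReal) (thresholdAux c.1 c.2 n (i :: v))} := fun i =>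
      measurableSet_lt measurable_const
        ((measurable_coe_real_ereal.comp (by fun_prop)).max (measurable_thresholdAux _ _))
    have hA : MeasurableSet {c : (List ℕ → ℕ) × (List ℕ → ℝ) | c.1 v = N ∧ ∀ i < M, (p : EReal) <
        max (c.2 (i :: v) : EReal) (thresholdAux c.1 c.2 n (i :: v))} := by
      refine measurableSet_setOfPred.2 (Measurable.and ?_ (Measurable.forall fun i =>
        Measurable.imp measurable_const (measurableSet_setOfPred.1 (hm i))))
      exact measurableSet_setOfPred.1 (measurableSet_eq_fun (by fun_prop) measurable_const)
    have hmul := hind.measure_inter_preimage_eq_mul _ _ hA (hm M)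
    have h1 : (fun ω => restrictConfig S (X ω, U ω)) ⁻¹' {c | c.1 v = N ∧ ∀ i < M, (p : EReal) <
        max (c.2 (i :: v) : EReal) (thresholdAux c.1 c.2 n (i :: v))} =
        {ω | X ω v = N ∧ ∀ i < M, (p : EReal) <
          max (U ω (i :: v) : EReal) (thresholdAux (X ω) (U ω) n (i :: v))} := by
      ext ω
      simp only [Set.mem_preimage, Set.mem_ofPred_eq]
      rw [restrictConfig_fst (show (v, false) ∈ S from fun hs => by
        have := hs.length_le
        simp at this)]
      refine and_congr_right fun _ => forall₂_congr fun i hi => ?_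
      have hS : ∀ y b, i :: v <:+ y → (y, b) ∈ S := fun y b hy =>
        not_suffix_of_cons_suffix hi.ne hy
      rw [thresholdAux_restrictConfig (fun y hy => hS y _ hy) (fun y hy _ => hS y _ hy),
        restrictConfig_snd (hS _ _ (List.suffix_refl _))]
    have h2 : (fun ω => restrictConfig Sᶜ (X ω, U ω)) ⁻¹' {c | (p : EReal) <
        max (c.2 (M :: v) : EReal) (thresholdAux c.1 c.2 n (M :: v))} =
        {ω | (p : EReal) < max (U ω (M :: v) : EReal) (thresholdAux (X ω) (U ω) n (M :: v))} := by
      ext ω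
      simp only [Set.mem_preimage, Set.mem_ofPred_eq]
      have hS : ∀ y b, M :: v <:+ y → (y, b) ∈ Sᶜ := fun y b hy hn => hn hy
      rw [thresholdAux_restrictConfig (fun y hy => hS y _ hy) (fun y hy _ => hS y _ hy),
        restrictConfig_snd (hS _ _ (List.suffix_refl _))]
    rw [h1, h2] at hmul
    have hset : {ω | X ω v = N ∧ ∀ i < M + 1, (p : EReal) <
        max (U ω (i :: v) : EReal) (thresholdAux (X ω) (U ω) n (i :: v))} =
        {ω | X ω v = N ∧ ∀ i < M, (p : EReal) <
          max (U ω (i :: v) : EReal) (thresholdAux (X ω) (U ω) n (i :: v))} ∩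
        {ω | (p : EReal) < max (U ω (M :: v) : EReal) (thresholdAux (X ω) (U ω) n (M :: v))} := by
      ext ω
      simp only [Set.mem_ofPred_eq, Set.mem_inter_iff, Nat.lt_succ_iff_lt_or_eq, or_imp, forall_and,
        forall_eq, and_assoc]
    rw [hset, measureReal_def, hmul, ENNReal.toReal_mul, ← measureReal_def, ← measureReal_def, ih,
      hs M, pow_succ, mul_assoc]

/-- Partition the complementary event by the offspring number: all `N` branches fail with
probability `(1 - weightCDF p * s) ^ N`. -/
theorem measureReal_thresholdAux_succ (v : List ℕ) (n : ℕ) (p s : ℝ)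
    (hs : ∀ i, P.real {ω | thresholdAux (X ω) (U ω) n (i :: v) ≤ p} = s) :
    P.real {ω | thresholdAux (X ω) (U ω) (n + 1) v ≤ p} = keepProb ν (weightCDF p * s) := by
  have hmeas : MeasurableSet {ω | thresholdAux (X ω) (U ω) (n + 1) v ≤ p} :=
    measurableSet_le ((measurable_thresholdAux (n + 1) v).comp h.measurable_config) measurable_const
  have hs' : ∀ i, P.real {ω | (p : EReal) <
      max (U ω (i :: v) : EReal) (thresholdAux (X ω) (U ω) n (i :: v))} = 1 - weightCDF p * s :=
    fun i => by rw [h.measureReal_lt_max, hs]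
  have hsI : s ∈ Set.Icc (0 : ℝ) 1 := hs 0 ▸ ⟨measureReal_nonneg, measureReal_le_one⟩
  have hqI : weightCDF p * s ∈ Set.Icc (0 : ℝ) 1 :=
    ⟨mul_nonneg (weightCDF_mem_Icc p).1 hsI.1, mul_le_one₀ (weightCDF_mem_Icc p).2 hsI.1 hsI.2⟩
  let E : ℕ → Set Ω := fun N => {ω | X ω v = N ∧ ∀ i < N, (p : EReal) <
      max (U ω (i :: v) : EReal) (thresholdAux (X ω) (U ω) n (i :: v))}
  have hE : ∀ N, MeasurableSet (E N) := by
    intro N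
    refine measurableSet_setOfPred.2 (Measurable.and ?_ (Measurable.forall fun i =>
      Measurable.imp measurable_const ?_))
    · exact measurableSet_setOfPred.1 (measurableSet_eq_fun (h.measurable_offspring v)
        measurable_const)
    · exact measurableSet_setOfPred.1 (measurableSet_lt measurable_const
        ((measurable_coe_real_ereal.comp (h.measurable_weight _)).max
          ((measurable_thresholdAux _ _).comp h.measurable_config)))
  have hset : {ω | thresholdAux (X ω) (U ω) (n + 1) v ≤ p}ᶜ = ⋃ N, E N := by
    ext ω
    simp only [Set.mem_compl_iff, Set.mem_ofPred_eq, not_le, Set.mem_iUnion, E]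
    rw [thresholdAux, Finset.lt_inf_iff (EReal.coe_lt_top p)]
    simp
  have hdisj : Pairwise (Function.onFun Disjoint E) := by
    intro N M hNM
    refine Set.disjoint_left.2 fun ω h1 h2 => hNM (h1.1.symm.trans h2.1)
  have hcompl : P.real {ω | thresholdAux (X ω) (U ω) (n + 1) v ≤ p}ᶜ =
      ∫ N, (1 - weightCDF p * s) ^ N ∂ν := by
    rw [hset, measureReal_def, measure_iUnion hdisj hE,
      ENNReal.tsum_toReal_eq fun N => measure_ne_top _ _,
      integral_countable (integrable_one_sub_pow hqI)]
    refine tsum_congr fun N => ?_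
    rw [smul_eq_mul, ← h.measureReal_children v n N N p _ hs']
    rfl
  rw [probReal_compl_eq_one_sub hmeas] at hcompl
  rw [keepProb, ← hcompl]
  ring

/-- The iteration of survival probabilities up to generation `n`. -/
theorem measureReal_thresholdAux (v : List ℕ) (n : ℕ) (p : ℝ) :
    P.real {ω | thresholdAux (X ω) (U ω) n v ≤ p} =
      (fun s => keepProb ν (weightCDF p * s))^[n] 1 := by
  induction n generalizing v with
  | zero => simp [thresholdAux]
  | succ n ih =>
    rw [h.measureReal_thresholdAux_succ v n p _ fun i => ih (i :: v), Function.iterate_succ_apply']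

/-- The left side `s` is a fixed point of the survival recursion at `p`. Strict concavity pushes any
`t'` in `(0, s)` strictly upward, and by continuity still does so at some `p' < p`. The recursion at
`p'` started from `1` then never drops below `t'`, so the threshold is at most `p'` with probability
at least `t'`. -/
theorem measureReal_threshold_lt (hν : ν {n | 2 ≤ n} ≠ 0) (v : List ℕ) (p : ℝ) :
    P.real {ω | threshold (X ω) (U ω) v ≤ p} ≤ P.real {ω | threshold (X ω) (U ω) v < p} := by
  set s := P.real {ω | threshold (X ω) (U ω) v ≤ p} with hsdef
  have hsI : s ∈ Set.Icc (0 : ℝ) 1 := ⟨measureReal_nonneg, measureReal_le_one⟩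
  have hprod : ∀ p t, t ∈ Set.Icc (0 : ℝ) 1 → weightCDF p * t ∈ Set.Icc (0 : ℝ) 1 := fun p t ht =>
    ⟨mul_nonneg (weightCDF_mem_Icc p).1 ht.1, mul_le_one₀ (weightCDF_mem_Icc p).2 ht.1 ht.2⟩
  have hfix : keepProb ν (weightCDF p * s) = s := by
    have h1 := h.tendsto_measureReal_thresholdAux v p
    have h2 : Tendsto (fun n => P.real {ω | thresholdAux (X ω) (U ω) (n + 1) v ≤ p}) atTop
        (𝓝 (keepProb ν (weightCDF p * s))) := by
      have h3 : ∀ n, P.real {ω | thresholdAux (X ω) (U ω) (n + 1) v ≤ p} =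
          keepProb ν (weightCDF p * P.real {ω | thresholdAux (X ω) (U ω) n v ≤ p}) := fun n => by
        rw [h.measureReal_thresholdAux, h.measureReal_thresholdAux, Function.iterate_succ_apply']
      rw [funext h3]
      refine (continuousOn_keepProb _ (hprod p s hsI)).tendsto.comp
        (tendsto_nhdsWithin_iff.2 ⟨h1.const_mul _, Eventually.of_forall fun n => ?_⟩)
      exact hprod p _ ⟨measureReal_nonneg, measureReal_le_one⟩
    exact tendsto_nhds_unique h2 (h1.comp (tendsto_add_atTop_nat 1))
  refine le_of_forall_lt fun t hts => ?_
  rcases lt_or_ge t 0 with ht0 | ht0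
  · exact ht0.trans_le measureReal_nonneg
  have hspos : 0 < s := ht0.trans_lt hts
  have hqpos : 0 < weightCDF p * s := by
    refine lt_of_le_of_ne (hprod p s hsI).1 fun h0 => ?_
    rw [← h0, keepProb_zero] at hfix
    exact hspos.ne hfix
  obtain ⟨t', htt', ht's⟩ := exists_between hts
  have ht'I : t' ∈ Set.Icc (0 : ℝ) 1 := ⟨ht0.trans htt'.le, ht's.le.trans hsI.2⟩
  have hlt : t' < keepProb ν (weightCDF p * t') := by
    -- The ratio `r = t' / s` carries the fixed point `s` to `t'`.
    have := mul_keepProb_lt hν hqpos (hprod p s hsI).2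
      (div_pos (ht0.trans_lt htt') hspos) ((div_lt_one hspos).2 ht's)
    rw [hfix, div_mul_cancel₀ _ hspos.ne'] at this
    rwa [show t' / s * (weightCDF p * s) = weightCDF p * t' by field_simp] at this
  have hcont : Continuous fun p' => keepProb ν (weightCDF p' * t') :=
    continuousOn_keepProb.comp_continuous (continuous_weightCDF.mul_const t')
      fun p' => hprod p' t' ht'I
  obtain ⟨p', hp', hp'p⟩ : ∃ p', t' < keepProb ν (weightCDF p' * t') ∧ p' < p := by
    have h1 : ∀ᶠ p' in 𝓝[<] p, t' < keepProb ν (weightCDF p' * t') :=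
      (hcont.tendsto p).mono_left nhdsWithin_le_nhds |>.eventually (lt_mem_nhds hlt)
    exact (h1.and self_mem_nhdsWithin).exists
  have hiter : ∀ n, t' ≤ P.real {ω | thresholdAux (X ω) (U ω) n v ≤ p'} := by
    intro n
    induction n with
    | zero => rw [h.measureReal_thresholdAux]; exact ht'I.2
    | succ n ih =>
      rw [h.measureReal_thresholdAux, Function.iterate_succ_apply', ← h.measureReal_thresholdAux v]
      refine hp'.le.trans (keepProb_mono (hprod p' t' ht'I)
        (hprod p' _ ⟨measureReal_nonneg, measureReal_le_one⟩) ?_)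
      exact mul_le_mul_of_nonneg_left ih (weightCDF_mem_Icc p').1
  refine htt'.trans_le ((ge_of_tendsto' (h.tendsto_measureReal_thresholdAux v p') hiter).trans
    (measureReal_mono fun ω hω => ?_))
  exact lt_of_le_of_lt hω (EReal.coe_lt_coe_iff.2 hp'p)

theorem measure_threshold_eq (hν : ν {n | 2 ≤ n} ≠ 0) (v : List ℕ) (p : ℝ) :
    P {ω | threshold (X ω) (U ω) v = p} = 0 := by
  have hm := (measurable_threshold v).comp h.measurable_config
  have hlt : MeasurableSet {ω | threshold (X ω) (U ω) v < p} :=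
    measurableSet_lt hm measurable_const
  have hset : {ω | threshold (X ω) (U ω) v = p} =
      {ω | threshold (X ω) (U ω) v ≤ p} \ {ω | threshold (X ω) (U ω) v < p} := by
    ext ω
    simp only [Set.mem_ofPred_eq, Set.mem_sdiff, not_lt]
    exact le_antisymm_iff
  have hle := h.measureReal_threshold_lt hν v p
  have hsub : {ω | threshold (X ω) (U ω) v < p} ⊆ {ω | threshold (X ω) (U ω) v ≤ p} :=
    fun ω (hω : threshold (X ω) (U ω) v < p) => hω.le
  rw [hset, measure_sdiff hsub hlt.nullMeasurableSet
    (measure_ne_top _ _), tsub_eq_zero_iff_le]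
  exact (ENNReal.toReal_le_toReal (measure_ne_top _ _) (measure_ne_top _ _)).1 hle

end IsWeightedBPTree

/-! ### Almost sure regularity -/

/-- If the offspring number were at most one, the tail beyond any `y ≥ 1` would vanish, and the tail
ratio could not tend to `1`. -/
theorem IsPowerLawOffspring.measure_two_le_ne_zero {ν : Measure ℕ} {α c : ℝ}
    (hν : IsPowerLawOffspring ν α c) : ν {n | 2 ≤ n} ≠ 0 := by
  intro h0
  have h1 : ∀ᶠ y : ℝ in atTop, (1 / 2 : ℝ) < ν.real {n : ℕ | y < n} / (c * y ^ (-α)) :=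
    hν.tail.eventually (lt_mem_nhds (by norm_num))
  obtain ⟨y, hy, hy1⟩ := (h1.and (eventually_ge_atTop 1)).exists
  have h2 : ν {n : ℕ | y < n} = 0 := by
    refine measure_mono_null (fun n hn => ?_) h0
    have : (1 : ℝ) < n := lt_of_le_of_lt hy1 hn
    exact_mod_cast this
  rw [measureReal_def, h2] at hy
  norm_num at hy

namespace IsWeightedBPTree

variable {Ω : Type*} [MeasurableSpace Ω] {P : Measure Ω} {ν : Measure ℕ} {X : Ω → List ℕ → ℕ} {U : Ω → List ℕ → ℝ}
  (h : IsWeightedBPTree P ν X U)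
include h

theorem ae_one_le_offspring [SFinite ν] (hν : ν {0} = 0) : ∀ᵐ ω ∂P, ∀ v, 1 ≤ X ω v := by
  rw [ae_all_iff]
  intro v
  have h1 : ∀ᵐ n ∂(P.map fun ω => X ω v), 1 ≤ n := by
    rw [h.map_offspring, ae_iff]
    convert hν using 2
    ext n
    simp
  exact ae_of_ae_map (h.measurable_offspring v).aemeasurable h1

variable [IsProbabilityMeasure ν]

theorem measure_weight_eq (v : List ℕ) (p : ℝ) : P {ω | U ω v = p} = 0 := by
  rw [← unif_one_singleton p, ← h.map_weight v,
    Measure.map_apply (h.measurable_weight v) (measurableSet_singleton p)]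
  rfl

theorem ae_weight_mem_Ioc : ∀ᵐ ω ∂P, ∀ v, U ω v ∈ Set.Ioc (0 : ℝ) 1 := by
  rw [ae_all_iff]
  intro v
  have h1 : ∀ᵐ r ∂(P.map fun ω => U ω v), r ∈ Set.Icc (0 : ℝ) 1 := by
    rw [h.map_weight, unif_one_eq]
    exact ae_restrict_mem measurableSet_Icc
  filter_upwards [ae_of_ae_map (h.measurable_weight v).aemeasurable h1,
    measure_eq_zero_iff_ae_notMem.1 (h.measure_weight_eq v 0)] with ω h2 h3
  exact ⟨lt_of_le_of_ne h2.1 (Ne.symm h3), h2.2⟩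

variable [IsProbabilityMeasure P]

theorem ae_injective_weight : ∀ᵐ ω ∂P, Function.Injective (U ω) := by
  have h1 : ∀ᵐ ω ∂P, ∀ y z, y ≠ z → U ω y ≠ U ω z := by
    simp only [ae_all_iff]
    intro y z hyz
    refine ae_ne_of_indepFun (h.measurable_weight y) (h.measurable_weight z) ?_
      fun p => h.measure_weight_eq y p
    exact (h.indep.indepFun hyz).comp measurable_snd measurable_snd
  filter_upwards [h1] with ω hω y z hyz
  by_contra hne
  exact hω y z hne hyz

/-- The weight at `y` is atomless and independent of the subtree of `z`, to which `y` does not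
belong. -/
theorem ae_threshold_ne : ∀ᵐ ω ∂P, ∀ y z, ¬ z <:+ y → threshold (X ω) (U ω) z ≠ U ω y := by
  simp only [ae_all_iff]
  intro y z hyz
  have hc : Measurable fun ω => (U ω y : EReal) :=
    measurable_coe_real_ereal.comp (h.measurable_weight y)
  let S : Set (List ℕ × Bool) := {q | ¬ z <:+ q.1}
  have hind : IndepFun (fun ω => (U ω y : EReal)) (fun ω => threshold (X ω) (U ω) z) P := by
    have h1 := (h.indepFun_restrictConfig (S := S) (T := Sᶜ) disjoint_compl_right).comp
      (φ := fun c => (c.2 y : EReal)) (ψ := fun c => threshold c.1 c.2 z)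
      (measurable_coe_real_ereal.comp (by fun_prop)) (measurable_threshold z)
    have hS : ∀ y b, z <:+ y → (y, b) ∈ Sᶜ := fun y b hy hn => hn hy
    have h2 : ((fun c : (List ℕ → ℕ) × (List ℕ → ℝ) => (c.2 y : EReal)) ∘
        fun ω => restrictConfig S (X ω, U ω)) = fun ω => (U ω y : EReal) := by
      funext ω
      simp only [Function.comp_apply]
      rw [restrictConfig_snd (show (y, true) ∈ S from hyz)]
    have h3 : ((fun c : (List ℕ → ℕ) × (List ℕ → ℝ) => threshold c.1 c.2 z) ∘
        fun ω => restrictConfig Sᶜ (X ω, U ω)) = fun ω => threshold (X ω) (U ω) z := by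
      funext ω
      simp only [Function.comp_apply]
      rw [threshold_restrictConfig (fun y hy => hS y _ hy) fun y hy _ => hS y _ hy]
    rwa [h2, h3] at h1
  have := ae_ne_of_indepFun hc ((measurable_threshold z).comp h.measurable_config) hind fun b => by
    induction b with
    | bot => exact measure_mono_null (t := ∅) (fun ω hω => EReal.coe_ne_bot _ hω) measure_empty
    | top => exact measure_mono_null (t := ∅) (fun ω hω => EReal.coe_ne_top _ hω) measure_empty
    | coe p =>
      rw [← h.measure_weight_eq y p]
      congr 1
      ext ω
      simp
  filter_upwards [this] with ω hω
  exact hω.symm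

/-- Sibling branches are disjoint, hence independent, and a branch threshold is atomless as the
maximum of an atomless weight and an atomless threshold. The values `⊥` and `⊤` need separate
treatment. -/
theorem ae_branchThreshold_ne (hν0 : ν {0} = 0) (hν : ν {n | 2 ≤ n} ≠ 0) :
    ∀ᵐ ω ∂P, ∀ v i j, i ≠ j →
      branchThreshold (X ω) (U ω) (i :: v) ≠ branchThreshold (X ω) (U ω) (j :: v) := by
  simp only [ae_all_iff]
  intro v i j hij
  let S : Set (List ℕ × Bool) := {q | i :: v <:+ q.1}
  have hind : IndepFun (fun ω => branchThreshold (X ω) (U ω) (i :: v))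
      (fun ω => branchThreshold (X ω) (U ω) (j :: v)) P := by
    have h1 := (h.indepFun_restrictConfig (S := S) (T := Sᶜ) disjoint_compl_right).comp
      (φ := fun c => branchThreshold c.1 c.2 (i :: v))
      (ψ := fun c => branchThreshold c.1 c.2 (j :: v))
      (measurable_branchThreshold _) (measurable_branchThreshold _)
    have h2 : ((fun c : (List ℕ → ℕ) × (List ℕ → ℝ) => branchThreshold c.1 c.2 (i :: v)) ∘
        fun ω => restrictConfig S (X ω, U ω)) =
        fun ω => branchThreshold (X ω) (U ω) (i :: v) := by
      funext ω
      exact branchThreshold_restrictConfig (fun y b hy => hy) _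
    have h3 : ((fun c : (List ℕ → ℕ) × (List ℕ → ℝ) => branchThreshold c.1 c.2 (j :: v)) ∘
        fun ω => restrictConfig Sᶜ (X ω, U ω)) =
        fun ω => branchThreshold (X ω) (U ω) (j :: v) := by
      funext ω
      exact branchThreshold_restrictConfig
        (fun y b hy => not_suffix_of_cons_suffix hij.symm hy) _
    rwa [h2, h3] at h1
  refine ae_ne_of_indepFun ((measurable_branchThreshold _).comp h.measurable_config)
    ((measurable_branchThreshold _).comp h.measurable_config) hind fun b => ?_
  induction b with
  | bot =>
    refine measure_mono_null (t := ∅) (fun ω hω => ?_) measure_empty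
    exact EReal.coe_ne_bot _ (le_bot_iff.1 ((le_max_left _ _).trans (le_of_eq hω)))
  | top =>
    refine measure_eq_zero_iff_ae_notMem.2 ?_
    filter_upwards [h.ae_one_le_offspring hν0, h.ae_weight_mem_Ioc] with ω h1 h2 h3
    have := branchThreshold_le_one h1 (fun v => (h2 v).2) (i :: v)
    rw [show branchThreshold (X ω) (U ω) (i :: v) = ⊤ from h3] at this
    exact absurd this (not_le.2 (EReal.coe_lt_top 1))
  | coe p =>
    refine measure_mono_null (t := {ω | U ω (i :: v) = p} ∪
      {ω | threshold (X ω) (U ω) (i :: v) = p}) (fun ω hω => ?_)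
      (measure_union_null (h.measure_weight_eq _ p) (h.measure_threshold_eq hν _ p))
    have hω' : max (U ω (i :: v) : EReal) (threshold (X ω) (U ω) (i :: v)) = p := hω
    rcases max_choice (U ω (i :: v) : EReal) (threshold (X ω) (U ω) (i :: v)) with h' | h'
    · rw [h', EReal.coe_eq_coe_iff] at hω'
      exact Or.inl hω'
    · rw [h'] at hω'
      exact Or.inr hω'

theorem ae_isRegular (hν0 : ν {0} = 0) (hν : ν {n | 2 ≤ n} ≠ 0) :
    ∀ᵐ ω ∂P, IsRegular (X ω) (U ω) := by
  filter_upwards [h.ae_one_le_offspring hν0, h.ae_weight_mem_Ioc, h.ae_injective_weight,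
    h.ae_branchThreshold_ne hν0 hν, h.ae_threshold_ne] with ω h1 h2 h3 h4 h5
  exact ⟨h1, fun v => (h2 v).1, fun v => (h2 v).2, h3, h4, h5⟩

end IsWeightedBPTree

/-! ### Kernels of uniform variables -/

theorem unif_eq_smul (a : ℝ) : unif a = (ENNReal.ofReal a)⁻¹ • volume.restrict (Set.Icc 0 a) := by
  rw [unif, ProbabilityTheory.cond, Real.volume_Icc, sub_zero]

theorem isProbabilityMeasure_unif {a : ℝ} (ha : 0 < a) : IsProbabilityMeasure (unif a) :=
  cond_isProbabilityMeasure_of_finite (by simpa using ha) (by simp)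

theorem map_mul_unif_one {a : ℝ} (ha : 0 < a) : (unif 1).map (fun r => a * r) = unif a := by
  have hpre : (fun r => a * r) ⁻¹' Set.Icc 0 a = Set.Icc 0 1 := by
    ext r
    simp only [Set.mem_preimage, Set.mem_Icc]
    constructor
    · rintro ⟨h1, h2⟩
      exact ⟨nonneg_of_mul_nonneg_right h1 ha, le_of_mul_le_mul_left (by linarith) ha⟩
    · rintro ⟨h1, h2⟩
      exact ⟨mul_nonneg ha.le h1, by nlinarith⟩
  rw [unif_one_eq, ← hpre, ← Measure.restrict_map (measurable_const_mul a) measurableSet_Icc,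
    Real.map_volume_mul_left ha.ne', unif_eq_smul, Measure.restrict_smul, abs_of_pos (inv_pos.2 ha),
    ENNReal.ofReal_inv_of_pos ha]

theorem restrict_Iio_unif_one {a : ℝ} (ha : 0 < a) (ha1 : a ≤ 1) :
    (unif 1).restrict (Set.Iio a) = ENNReal.ofReal a • unif a := by
  rw [unif_eq_smul a, smul_smul, ENNReal.mul_inv_cancel (by simpa using ha) (by simp), one_smul,
    unif_one_eq, Measure.restrict_restrict measurableSet_Iio]
  refine Measure.restrict_congr_set ?_
  have : Set.Iio a ∩ Set.Icc 0 1 = Set.Ico 0 a := by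
    ext r
    simp only [Set.mem_inter_iff, Set.mem_Iio, Set.mem_Icc, Set.mem_Ico]
    constructor
    · rintro ⟨h1, h2, -⟩
      exact ⟨h2, h1⟩
    · rintro ⟨h1, h2⟩
      exact ⟨h2, h1, by linarith⟩
  rw [this]
  exact Ico_ae_eq_Icc

variable {ι : Type*} [Fintype ι]

/-- The law of a family of independent variables that are uniform on `[0, a]`, as a kernel in `a`. -/
noncomputable def unifKernel (ι : Type*) [Fintype ι] : Kernel ℝ (ι → ℝ) :=
  (Kernel.id ×ₖ Kernel.const ℝ (Measure.pi fun _ : ι => unif 1)).map fun q i => q.1 * q.2 i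

instance : IsMarkovKernel (unifKernel ι) := by
  rw [unifKernel]
  exact Kernel.IsMarkovKernel.map _ (by fun_prop)

/-- The kernel is built by scaling, which makes it measurable in `a` and Markov for every real `a`.
Positivity matters: `unif a` is the zero measure for `a ≤ 0`. -/
theorem unifKernel_apply {a : ℝ} (ha : 0 < a) :
    unifKernel ι a = Measure.pi fun _ : ι => unif a := by
  have := isProbabilityMeasure_unif ha
  rw [unifKernel, Kernel.map_apply _ (by fun_prop), Kernel.prod_apply, Kernel.id_apply,
    Kernel.const_apply, Measure.dirac_prod, Measure.map_map (by fun_prop) (by fun_prop)]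
  have h := Measure.pi_map_pi (μ := fun _ : ι => unif 1) (f := fun (_ : ι) (r : ℝ) => a * r)
    fun _ => (measurable_const_mul a).aemeasurable
  simp only [map_mul_unif_one ha] at h
  exact h

/-- Restricting the product to the cube restricts each factor, and a standard uniform law restricted
to values below `a` is `a` times the uniform law on `[0, a]`. -/
theorem measure_cube_inter {a : ℝ} (ha : 0 < a) (ha1 : a ≤ 1) {D : Set (ι → ℝ)}
    (hD : MeasurableSet D) :
    Measure.pi (fun _ : ι => unif 1) ({z | ∀ i, z i < a} ∩ D) =
      unifKernel ι a D * Measure.pi (fun _ : ι => unif 1) {z | ∀ i, z i < a} := by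
  have := isProbabilityMeasure_unif ha
  have hcube : {z : ι → ℝ | ∀ i, z i < a} = Set.pi Set.univ fun _ => Set.Iio a := by
    ext z
    simp
  have h1 : (Measure.pi fun _ : ι => unif 1).restrict {z | ∀ i, z i < a} =
      (ENNReal.ofReal a ^ Fintype.card ι) • Measure.pi fun _ : ι => unif a := by
    rw [hcube, Measure.restrict_pi_pi]
    simp only [restrict_Iio_unif_one ha ha1]
    have : IsFiniteMeasure (ENNReal.ofReal a • unif a) := by
      rw [← restrict_Iio_unif_one ha ha1]
      infer_instance
    refine Measure.pi_eq fun s hs => ?_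
    simp [Measure.pi_pi, Finset.prod_mul_distrib]
  have h2 : ∀ s, MeasurableSet s → Measure.pi (fun _ : ι => unif 1) ({z | ∀ i, z i < a} ∩ s) =
      ENNReal.ofReal a ^ Fintype.card ι * unifKernel ι a s := by
    intro s hs
    rw [Set.inter_comm, ← Measure.restrict_apply hs, h1, unifKernel_apply ha]
    rfl
  rw [h2 D hD, ← Set.inter_univ {z : ι → ℝ | ∀ i, z i < a}, h2 _ MeasurableSet.univ, measure_univ,
    mul_one, mul_comm]

/-- The law of the sum of `n` independent variables that are uniform on `[0, a]`, as a kernel in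
`(a, n)`. -/
noncomputable def unifSumKernel : Kernel (ℝ × ℕ) ℝ where
  toFun q := (unifKernel (Fin q.2) q.1).map fun z : Fin q.2 → ℝ => ∑ i, z i
  measurable' := measurable_from_prod_countable_left fun n =>
    (Measure.measurable_map (fun z : Fin n → ℝ => ∑ i, z i) (by fun_prop)).comp (unifKernel (Fin n)).measurable

theorem unifSumKernel_apply (a : ℝ) (n : ℕ) :
    unifSumKernel (a, n) = (unifKernel (Fin n) a).map fun z => ∑ i, z i := rfl

instance : IsMarkovKernel unifSumKernel :=
  ⟨fun q => Measure.isProbabilityMeasure_map (μ := unifKernel (Fin q.2) q.1)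
    (Measurable.aemeasurable (by fun_prop))⟩

theorem unifSumKernel_eq_unifSum {a : ℝ} (ha : 0 < a) (n : ℕ) :
    unifSumKernel (a, n) = unifSum a n := by
  rw [unifSumKernel_apply, unifKernel_apply ha, unifSum]

theorem map_sum_unifKernel {a : ℝ} (ha : 0 < a) :
    (unifKernel ι a).map (fun z => ∑ i, z i) = unifSumKernel (a, Fintype.card ι) := by
  have := isProbabilityMeasure_unif ha
  let e := Fintype.equivFin ι
  have h1 := (measurePreserving_piCongrLeft (fun _ : Fin (Fintype.card ι) => unif a) e).map_eq
  rw [unifSumKernel_apply, unifKernel_apply ha, unifKernel_apply ha, ← h1,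
    Measure.map_map (by fun_prop) (MeasurableEquiv.measurable _)]
  congr 1
  funext z
  simp only [Function.comp_apply]
  rw [← e.sum_comp]
  refine Finset.sum_congr rfl fun i _ => ?_
  simp [MeasurableEquiv.coe_piCongrLeft]

/-- Resampling: if `Y` is independent of the family `Z` of standard uniform variables, then on the
event that `Z` lies below the level `m Y`, the family `Z` is uniform on `[0, m Y]` given `Y`. -/
theorem measure_and_lt_level {Ω 𝓨 : Type*} [MeasurableSpace Ω] [MeasurableSpace 𝓨]
    {P : Measure Ω} [IsProbabilityMeasure P] {Y : Ω → 𝓨} {Z : Ω → ι → ℝ} (hY : Measurable Y)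
    (hZ : Measurable Z) (hYZ : IndepFun Y Z P)
    (hlaw : P.map Z = Measure.pi fun _ : ι => unif 1) {m : 𝓨 → ℝ} (hm : Measurable m) {A : Set 𝓨}
    (hA : MeasurableSet A) (hmA : ∀ y ∈ A, 0 < m y ∧ m y ≤ 1) {D : Set (ι → ℝ)}
    (hD : MeasurableSet D) :
    P ({ω | Y ω ∈ A ∧ ∀ i, Z ω i < m (Y ω)} ∩ Z ⁻¹' D) =
      ∫⁻ ω in {ω | Y ω ∈ A ∧ ∀ i, Z ω i < m (Y ω)}, unifKernel ι (m (Y ω)) D ∂P := by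
  have hmap := (indepFun_iff_map_prod_eq_prod_map_map hY.aemeasurable hZ.aemeasurable).1 hYZ
  rw [hlaw] at hmap
  have hE : MeasurableSet {q : 𝓨 × (ι → ℝ) | q.1 ∈ A ∧ ∀ i, q.2 i < m q.1} :=
    (measurable_fst hA).inter (measurableSet_setOfPred.2 (Measurable.forall fun i =>
      measurableSet_setOfPred.1 (measurableSet_lt (by fun_prop) (by fun_prop))))
  have hker : Measurable fun q : 𝓨 × (ι → ℝ) => unifKernel ι (m q.1) D :=
    ((unifKernel ι).measurable_coe hD).comp (hm.comp measurable_fst)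
  have hpair : Measurable fun ω => (Y ω, Z ω) := hY.prodMk hZ
  have hL : {ω | Y ω ∈ A ∧ ∀ i, Z ω i < m (Y ω)} ∩ Z ⁻¹' D = (fun ω => (Y ω, Z ω)) ⁻¹'
      ({q : 𝓨 × (ι → ℝ) | q.1 ∈ A ∧ ∀ i, q.2 i < m q.1} ∩ Prod.snd ⁻¹' D) := rfl
  have hR : {ω | Y ω ∈ A ∧ ∀ i, Z ω i < m (Y ω)} = (fun ω => (Y ω, Z ω)) ⁻¹'
      {q : 𝓨 × (ι → ℝ) | q.1 ∈ A ∧ ∀ i, q.2 i < m q.1} := rfl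
  rw [hL, hR, ← Measure.map_apply hpair (hE.inter (measurable_snd hD)),
    ← setLIntegral_map hE hker hpair, hmap, Measure.prod_apply (hE.inter (measurable_snd hD)),
    ← lintegral_indicator hE, lintegral_prod _ (hker.indicator hE).aemeasurable]
  refine lintegral_congr fun y => ?_
  by_cases hy : y ∈ A
  · have h1 : Prod.mk y ⁻¹' ({q : 𝓨 × (ι → ℝ) | q.1 ∈ A ∧ ∀ i, q.2 i < m q.1} ∩ Prod.snd ⁻¹' D) =
        {z | ∀ i, z i < m y} ∩ D := by
      ext z
      simp [hy]
    have hcube : MeasurableSet {z : ι → ℝ | ∀ i, z i < m y} :=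
      measurableSet_setOfPred.2 (Measurable.forall fun i =>
        measurableSet_setOfPred.1 (measurableSet_lt (by fun_prop) measurable_const))
    have h2 : ∀ z, Set.indicator {q : 𝓨 × (ι → ℝ) | q.1 ∈ A ∧ ∀ i, q.2 i < m q.1}
        (fun q => unifKernel ι (m q.1) D) (y, z) =
        Set.indicator {z : ι → ℝ | ∀ i, z i < m y} (fun _ => unifKernel ι (m y) D) z := by
      intro z
      simp [Set.indicator, hy]
    rw [h1, measure_cube_inter (hmA y hy).1 (hmA y hy).2 hD]
    simp only [h2]
    rw [lintegral_indicator hcube, setLIntegral_const]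
  · have h1 : Prod.mk y ⁻¹' ({q : 𝓨 × (ι → ℝ) | q.1 ∈ A ∧ ∀ i, q.2 i < m q.1} ∩ Prod.snd ⁻¹' D) =
        ∅ := by
      ext z
      simp [hy]
    rw [h1]
    simp [Set.indicator, hy]

/-! ### Disintegration and mixtures -/

theorem map_prodMk_eq_compProd {Ω β γ : Type*} [MeasurableSpace Ω] [MeasurableSpace β]
    [MeasurableSpace γ] {μ : Measure Ω} [IsFiniteMeasure μ] {W : Ω → β} {Z : Ω → γ}
    {κ : Kernel β γ} [IsFiniteKernel κ] (hW : Measurable W) (hZ : AEMeasurable Z μ)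
    (h : ∀ B D, MeasurableSet B → MeasurableSet D →
      μ (W ⁻¹' B ∩ Z ⁻¹' D) = ∫⁻ ω in W ⁻¹' B, κ (W ω) D ∂μ) :
    μ.map (fun ω => (W ω, Z ω)) = μ.map W ⊗ₘ κ := by
  have := Measure.isFiniteMeasure_map μ fun ω => (W ω, Z ω)
  refine Measure.ext_prod fun {B D} hB hD => ?_
  rw [Measure.map_apply_of_aemeasurable (hW.aemeasurable.prodMk hZ) (hB.prod hD),
    Measure.compProd_apply_prod hB hD, setLIntegral_map hB (κ.measurable_coe hD) hW]
  exact h B D hB hD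

theorem sum_measure_apply_eq_setLIntegral {Ω κ : Type*} [MeasurableSpace Ω] [Countable κ]
    {μ : κ → Measure Ω} {s t : Set Ω} {f : Ω → ℝ≥0∞} (h : ∀ i, μ i s = ∫⁻ ω in t, f ω ∂μ i) :
    Measure.sum μ s = ∫⁻ ω in t, f ω ∂Measure.sum μ := by
  rw [Measure.sum_apply_of_countable, Measure.restrict_sum_of_countable, lintegral_sum_measure]
  exact tsum_congr h

/-- If `H` has conditional law `c` given `W`, then `κ (W, H)` averages to the mixture of `κ` over
`c`. -/
theorem setLIntegral_eq_setLIntegral_compProd_snd {Ω β γ δ : Type*} [MeasurableSpace Ω]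
    [MeasurableSpace β] [MeasurableSpace γ] [MeasurableSpace δ] {μ : Measure Ω} [IsFiniteMeasure μ]
    {W : Ω → β} {H : Ω → γ} {c : Kernel β γ} [IsSFiniteKernel c] {κ : Kernel (β × γ) δ}
    [IsSFiniteKernel κ] (hW : Measurable W) (hH : AEMeasurable H μ)
    (hc : μ.map (fun ω => (W ω, H ω)) = μ.map W ⊗ₘ c) {B : Set β} (hB : MeasurableSet B) {D : Set δ}
    (hD : MeasurableSet D) :
    ∫⁻ ω in W ⁻¹' B, κ (W ω, H ω) D ∂μ = ∫⁻ ω in W ⁻¹' B, (c ⊗ₖ κ).snd (W ω) D ∂μ := by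
  let g : β × γ → ℝ≥0∞ := (Prod.fst ⁻¹' B).indicator fun q => κ q D
  have hg : Measurable g := (κ.measurable_coe hD).indicator (measurable_fst hB)
  have h1 : ∀ a, (c ⊗ₖ κ).snd a D = ∫⁻ n, κ (a, n) D ∂c a := fun a => by
    rw [Kernel.snd_apply' _ _ hD, Kernel.compProd_apply (measurable_snd hD)]
    rfl
  calc ∫⁻ ω in W ⁻¹' B, κ (W ω, H ω) D ∂μ = ∫⁻ ω, g (W ω, H ω) ∂μ := by
        rw [← lintegral_indicator (hW hB)]
        rfl
    _ = ∫⁻ q, g q ∂(μ.map W ⊗ₘ c) := by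
        rw [← hc, lintegral_map' hg.aemeasurable (hW.aemeasurable.prodMk hH)]
    _ = ∫⁻ a in B, (c ⊗ₖ κ).snd a D ∂(μ.map W) := by
        rw [Measure.lintegral_compProd hg, ← lintegral_indicator hB]
        refine lintegral_congr fun a => ?_
        by_cases ha : a ∈ B
        · simp [g, ha, Set.indicator, h1]
        · simp [g, ha, Set.indicator]
    _ = ∫⁻ ω in W ⁻¹' B, (c ⊗ₖ κ).snd (W ω) D ∂μ :=
        setLIntegral_map hB (Kernel.measurable_coe _ hD) hW

/-! ### The law of the weights of the forest -/

open Classical in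
/-- The threshold of the selected vertex of generation `k`. -/
noncomputable def selectedThreshold (k : ℕ) (c : (List ℕ → ℕ) × (List ℕ → ℝ)) : ℝ :=
  (⨆ u, if u.length = k ∧ IsSelected c.1 c.2 u then threshold c.1 c.2 u else ⊥).toReal

theorem measurable_selectedThreshold (k : ℕ) : Measurable (selectedThreshold k) := by
  refine measurable_ereal_toReal.comp (Measurable.iSup fun u => Measurable.ite ?_
    (measurable_threshold u) measurable_const)
  exact measurableSet_setOfPred.2 (measurable_const.and
    (measurableSet_setOfPred.1 (measurableSet_isSelected u)))

namespace IsRegular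

variable {x : List ℕ → ℕ} {w : List ℕ → ℝ} (h : IsRegular x w)
include h

open Classical in
-- Gives a measurable version of the future maximum, whose definition chooses the backbone by
-- `Classical.epsilon`. Only one vertex of generation `k` is selected, so the supremum has one
-- relevant term.
theorem futureMax_eq (k : ℕ) : futureMax x w k = selectedThreshold k (x, w) := by
  have hb := h.isBackbone_backbone
  have hsup : (⨆ u, if u.length = k ∧ IsSelected x w u then threshold x w u else ⊥) =
      threshold x w (backbone x w k) := by
    apply le_antisymm
    · refine iSup_le fun u => ?_
      split_ifs with hu
      · rw [hu.2.unique (hb.isSelected h k) (by rw [hu.1, hb.length_eq])]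
      · exact bot_le
    · refine le_iSup_of_le (backbone x w k) ?_
      rw [if_pos ⟨hb.length_eq k, hb.isSelected h k⟩]
  rw [selectedThreshold, hsup, ← h.coe_futureMax, EReal.toReal_coe]

theorem futureMax_pos (k : ℕ) : 0 < futureMax x w k :=
  (h.pos _).trans_le (le_csSup (h.bddAbove_futureMax k) ⟨k + 1, Nat.lt_succ_self k, rfl⟩)

theorem futureMax_le_one (k : ℕ) : futureMax x w k ≤ 1 :=
  csSup_le ⟨_, k + 1, Nat.lt_succ_self k, rfl⟩ (by rintro _ ⟨i, -, rfl⟩; exact h.le_one _)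

/-- Membership in the local event is expressed through the weights on `F` and the configuration in
which these weights are erased. -/
theorem isLocalForest_iff {u : List ℕ} {j : ℕ} {F : Finset (List ℕ)} {B : Set ℝ}
    {S : Set (List ℕ × Bool)} (hS : S = {q | q.2 = true → q.1 ∉ F})
    {c : (List ℕ → ℕ) × (List ℕ → ℝ)} (hc : c = restrictConfig S (x, w))
    {m : (List ℕ → ℕ) × (List ℕ → ℝ) → ℝ}
    (hm : m = fun c => (branchThreshold c.1 c.2 (j :: u)).toReal) :
    (IsLocalForest x w u j F ∧ futureMax x w u.length ∈ B ↔
      (IsLocalForest c.1 c.2 u j F ∧ (0 < m c ∧ m c ≤ 1) ∧ m c ∈ B) ∧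
        ∀ v : F, w v < m c) ∧
    (IsLocalForest x w u j F → m c = futureMax x w u.length) := by
  have hx : c.1 = x := by
    funext v
    rw [hc, restrictConfig_fst (by simp [hS])]
  have hw : ∀ y ∉ F, c.2 y = w y := fun y hy => by
    rw [hc, restrictConfig_snd (by simpa [hS] using hy)]
  have hwF : ∀ y ∈ F, c.2 y = -1 := fun y hy => by
    rw [hc, restrictConfig_snd_of_notMem (by simpa [hS] using hy)]
  have hmc : m c = (branchThreshold x c.2 (j :: u)).toReal := by simp only [hm, hx]
  have heq : IsLocalForest x w u j F → m c = futureMax x w u.length := fun hF => by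
    rw [hmc, ← hF.2.branchThreshold_eq fun y hy => (hw y hy).symm,
      ← h.coe_futureMax_of_isLocalForest hF, EReal.toReal_coe]
  refine ⟨⟨fun ⟨hF, hB⟩ => ?_, fun ⟨⟨hF, hpos, hB⟩, hlt⟩ => ?_⟩, heq⟩
  · have hbr := h.coe_futureMax_of_isLocalForest hF
    rw [heq hF, hx]
    refine ⟨⟨hF.resample (fun y hy => (hw y hy).symm) (fun y hy => ?_)
      (h.branchThreshold_lt_top _), ⟨h.futureMax_pos _, h.futureMax_le_one _⟩, hB⟩, fun v => ?_⟩
    · rw [← hbr, hwF y hy, EReal.coe_lt_coe_iff]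
      linarith [h.futureMax_pos u.length]
    · rw [← EReal.coe_lt_coe_iff, hbr]
      exact hF.2.inner v v.2
  · rw [hx] at hF
    -- `EReal.toReal` sends both infinite values to `0`, so positivity of `m c` rules them out.
    have htop : branchThreshold x c.2 (j :: u) ≠ ⊤ := fun he => by
      rw [hmc, he] at hpos
      simp at hpos
    have hbot : branchThreshold x c.2 (j :: u) ≠ ⊥ := fun he => by
      rw [hmc, he] at hpos
      simp at hpos
    have hF' : IsLocalForest x w u j F := by
      refine hF.resample hw (fun y hy => ?_) (lt_top_iff_ne_top.2 htop)
      rw [← EReal.coe_toReal htop hbot, ← hmc, EReal.coe_lt_coe_iff]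
      exact hlt ⟨y, hy⟩
    exact ⟨hF', heq hF' ▸ hB⟩

theorem isLocalForest_unique {u u' : List ℕ} {j j' : ℕ} {F : Finset (List ℕ)}
    (hl : u.length = u'.length) (hF : IsLocalForest x w u j F) (hF' : IsLocalForest x w u' j' F) :
    u = u' ∧ j = j' := by
  obtain ⟨h1, h2⟩ := h.backbone_eq_of_isLocalForest hF
  obtain ⟨h3, h4⟩ := h.backbone_eq_of_isLocalForest hF'
  rw [hl] at h1 h2
  have h5 := List.cons.inj (h2.symm.trans h4)
  exact ⟨h5.2, h5.1⟩

end IsRegular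

/-! ### Decomposition over the values of the forest -/

/-- The event that the forest off the backbone vertex of generation `k` is `F`, in terms of the
local description. -/
def forestEvent {Ω : Type*} (X : Ω → List ℕ → ℕ) (U : Ω → List ℕ → ℝ) (k : ℕ)
    (F : Finset (List ℕ)) : Set Ω :=
  ⋃ q : List ℕ × ℕ, {ω | q.1.length = k ∧ IsLocalForest (X ω) (U ω) q.1 q.2 F}

theorem ae_mem_forestEvent_iff {Ω : Type*} [MeasurableSpace Ω] {P : Measure Ω}
    {X : Ω → List ℕ → ℕ} {U : Ω → List ℕ → ℝ} (hreg : ∀ᵐ ω ∂P, IsRegular (X ω) (U ω)) (k : ℕ) :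
    ∀ᵐ ω ∂P, ∀ F : Finset (List ℕ), ω ∈ forestEvent X U k F ↔ forest (X ω) (U ω) k = F := by
  filter_upwards [hreg] with ω hω F
  rw [hω.forest_eq_iff]
  simp [forestEvent]

theorem forestEvent_ae_eq {Ω : Type*} [MeasurableSpace Ω] {P : Measure Ω}
    {X : Ω → List ℕ → ℕ} {U : Ω → List ℕ → ℝ} (hreg : ∀ᵐ ω ∂P, IsRegular (X ω) (U ω)) (k : ℕ) (F : Finset (List ℕ)) :
    {ω | forest (X ω) (U ω) k = F} =ᵐ[P] forestEvent X U k F := by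
  filter_upwards [ae_mem_forestEvent_iff hreg k] with ω hω
  exact propext (hω F).symm

namespace IsWeightedBPTree

variable {Ω : Type*} [MeasurableSpace Ω] {P : Measure Ω} {ν : Measure ℕ} {X : Ω → List ℕ → ℕ} {U : Ω → List ℕ → ℝ}

section

variable (h : IsWeightedBPTree P ν X U)
include h

theorem measurableSet_localEvent (k : ℕ) (F : Finset (List ℕ)) (q : List ℕ × ℕ) :
    MeasurableSet {ω | q.1.length = k ∧ IsLocalForest (X ω) (U ω) q.1 q.2 F} :=
  (MeasurableSet.const _).inter (h.measurable_config (measurableSet_isLocalForest q.1 q.2 F))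

theorem measurableSet_forestEvent (k : ℕ) (F : Finset (List ℕ)) :
    MeasurableSet (forestEvent X U k F) :=
  MeasurableSet.iUnion fun q => h.measurableSet_localEvent k F q

theorem measurable_selectedThreshold_config (k : ℕ) :
    Measurable fun ω => selectedThreshold k (X ω, U ω) :=
  (measurable_selectedThreshold k).comp h.measurable_config

theorem measurable_weights (F : Finset (List ℕ)) : Measurable fun ω (v : F) => U ω v :=
  measurable_pi_lambda _ fun v => h.measurable_weight v

variable [IsProbabilityMeasure P] [IsProbabilityMeasure ν]

theorem map_weights (F : Finset (List ℕ)) :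
    P.map (fun ω (v : F) => U ω v) = Measure.pi fun _ : F => unif 1 := by
  have h1 : iIndepFun (fun (v : F) ω => U ω v) P :=
    (h.indep.comp (fun _ => Prod.snd) fun _ => measurable_snd).precomp Subtype.val_injective
  have h2 := (iIndepFun_iff_map_fun_eq_pi_map
    fun v : F => (h.measurable_weight v).aemeasurable).1 h1
  simpa only [h.map_weight] using h2

end

variable (h : IsWeightedBPTree P ν X U) (hreg : ∀ᵐ ω ∂P, IsRegular (X ω) (U ω))
include h hreg

/-- For a regular configuration, the local event forces `u` and `j :: u` to be the backbone vertices
of generations `k` and `k + 1`, so different pairs give disjoint events up to null sets. -/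
theorem restrict_forestEvent (k : ℕ) (F : Finset (List ℕ)) :
    P.restrict (forestEvent X U k F) = Measure.sum fun q : List ℕ × ℕ =>
      P.restrict {ω | q.1.length = k ∧ IsLocalForest (X ω) (U ω) q.1 q.2 F} := by
  refine Measure.restrict_iUnion_ae (fun q q' hq => ?_)
    fun q => (h.measurableSet_localEvent k F q).nullMeasurableSet
  refine measure_eq_zero_iff_ae_notMem.2 ?_
  filter_upwards [hreg] with ω hω hωE
  have := hω.isLocalForest_unique (hωE.1.1.trans hωE.2.1.symm) hωE.1.2 hωE.2.2
  exact hq (Prod.ext this.1 this.2)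

/-- The forest is almost surely finite, so its countably many possible values partition the space up
to a null set. -/
theorem sum_restrict_forestEvent (k : ℕ) :
    (Measure.sum fun F => P.restrict (forestEvent X U k F)) = P := by
  rw [← Measure.restrict_iUnion_ae (fun F F' hF => ?_)
    fun F => (h.measurableSet_forestEvent k F).nullMeasurableSet]
  · refine Measure.restrict_eq_self_of_ae_mem ?_
    filter_upwards [hreg, ae_mem_forestEvent_iff hreg k] with ω hω hiff
    refine Set.mem_iUnion.2 ⟨(hω.finite_forest k).toFinset, (hiff _).2 ?_⟩
    simp
  · refine measure_eq_zero_iff_ae_notMem.2 ?_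
    filter_upwards [ae_mem_forestEvent_iff hreg k] with ω hω hωE
    exact hF (Finset.coe_injective (((hω F).1 hωE.1).symm.trans ((hω F').1 hωE.2)))

theorem ae_restrict_forestEvent (k : ℕ) (F : Finset (List ℕ)) :
    ∀ᵐ ω ∂P.restrict (forestEvent X U k F), 0 < selectedThreshold k (X ω, U ω) ∧
      forestSize (X ω) (U ω) k = F.card ∧ attachedWeight (X ω) (U ω) k = ∑ v : F, U ω v := by
  rw [ae_restrict_iff' (h.measurableSet_forestEvent k F)]
  filter_upwards [hreg, ae_mem_forestEvent_iff hreg k] with ω hω hiff hωF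
  have hF := (hiff F).1 hωF
  refine ⟨hω.futureMax_eq k ▸ hω.futureMax_pos k, ?_, ?_⟩
  · rw [forestSize, hF, Set.ncard_coe_finset]
  · rw [hω.attachedWeight_eq, hF, finsum_mem_coe_finset, ← Finset.sum_coe_sort]

theorem aemeasurable_futureMax (k : ℕ) : AEMeasurable (fun ω => futureMax (X ω) (U ω) k) P :=
  ⟨_, h.measurable_selectedThreshold_config k, hreg.mono fun _ hω => hω.futureMax_eq k⟩

theorem aemeasurable_forestSize (k : ℕ) : AEMeasurable (fun ω => forestSize (X ω) (U ω) k) P := by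
  rw [← h.sum_restrict_forestEvent hreg k, aemeasurable_sum_measure_iff]
  exact fun F => ⟨fun _ => F.card, measurable_const,
    (h.ae_restrict_forestEvent hreg k F).mono fun ω hω => hω.2.1⟩

theorem aemeasurable_attachedWeight (k : ℕ) :
    AEMeasurable (fun ω => attachedWeight (X ω) (U ω) k) P := by
  rw [← h.sum_restrict_forestEvent hreg k, aemeasurable_sum_measure_iff]
  exact fun F => ⟨fun ω => ∑ v : F, U ω v,
    Finset.measurable_fun_sum _ fun v _ => h.measurable_weight v,
    (h.ae_restrict_forestEvent hreg k F).mono fun ω hω => hω.2.2⟩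

theorem nullMeasurableSet_forest (k : ℕ) (F : Finset (List ℕ)) :
    NullMeasurableSet {ω | forest (X ω) (U ω) k = F} P :=
  (h.measurableSet_forestEvent k F).nullMeasurableSet.congr (forestEvent_ae_eq hreg k F).symm

variable [IsProbabilityMeasure P] [IsProbabilityMeasure ν]

/-- The heart of the matter. Let `Y` be the configuration with the weights on `F` erased. The local
event says that `Y` lies in a fixed set and that the erased weights lie below a level computed from
`Y`; these weights are independent of `Y`. -/
theorem measure_restrict_localEvent (k : ℕ) (F : Finset (List ℕ)) (q : List ℕ × ℕ) {B : Set ℝ}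
    (hB : MeasurableSet B) {D : Set (F → ℝ)} (hD : MeasurableSet D) :
    P.restrict {ω | q.1.length = k ∧ IsLocalForest (X ω) (U ω) q.1 q.2 F}
      ((fun ω => selectedThreshold k (X ω, U ω)) ⁻¹' B ∩ (fun ω (v : F) => U ω v) ⁻¹' D) =
    ∫⁻ ω in (fun ω => selectedThreshold k (X ω, U ω)) ⁻¹' B,
      unifKernel F (selectedThreshold k (X ω, U ω)) D
        ∂P.restrict {ω | q.1.length = k ∧ IsLocalForest (X ω) (U ω) q.1 q.2 F} := by
  obtain ⟨u, j⟩ := q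
  by_cases hk : u.length = k
  swap
  · simp [hk]
  subst hk
  simp only [true_and]
  let S : Set (List ℕ × Bool) := {q | q.2 = true → q.1 ∉ F}
  let m : (List ℕ → ℕ) × (List ℕ → ℝ) → ℝ := fun c => (branchThreshold c.1 c.2 (j :: u)).toReal
  have hm : Measurable m := measurable_ereal_toReal.comp (measurable_branchThreshold _)
  -- The bounds on `m c` are imposed explicitly because the erased configuration need not be
  -- regular.
  let A : Set ((List ℕ → ℕ) × (List ℕ → ℝ)) :=
    {c | IsLocalForest c.1 c.2 u j F ∧ (0 < m c ∧ m c ≤ 1) ∧ m c ∈ B}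
  have hA : MeasurableSet A := (measurableSet_isLocalForest u j F).inter
    (((measurableSet_lt measurable_const hm).inter (measurableSet_le hm measurable_const)).inter
      (hm hB))
  let Y : Ω → (List ℕ → ℕ) × (List ℕ → ℝ) := fun ω => restrictConfig S (X ω, U ω)
  have hY : Measurable Y := measurable_restrictConfig (fun v _ => h.measurable_offspring v)
    fun v _ => h.measurable_weight v
  have hYZ : IndepFun Y (fun ω (v : F) => U ω v) P := by
    have h1 := (h.indepFun_restrictConfig (S := S) (T := Sᶜ) disjoint_compl_right).comp
      (φ := id) (ψ := fun c (v : F) => c.2 v) measurable_id (by fun_prop)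
    have h2 : ((fun (c : (List ℕ → ℕ) × (List ℕ → ℝ)) (v : F) => c.2 v) ∘
        fun ω => restrictConfig Sᶜ (X ω, U ω)) = fun ω (v : F) => U ω v := by
      funext ω v
      simp only [Function.comp_apply]
      rw [restrictConfig_snd (by simp [S])]
    rwa [h2] at h1
  have key := measure_and_lt_level hY (h.measurable_weights F) hYZ (h.map_weights F) hm hA
    (fun c hc => hc.2.1) hD
  have hW := h.measurable_selectedThreshold_config u.length
  have hL : MeasurableSet {ω | IsLocalForest (X ω) (U ω) u j F} :=
    h.measurable_config (measurableSet_isLocalForest u j F)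
  have hset : ((fun ω => selectedThreshold u.length (X ω, U ω)) ⁻¹' B ∩
      {ω | IsLocalForest (X ω) (U ω) u j F} : Set Ω) =ᵐ[P]
      {ω | Y ω ∈ A ∧ ∀ v : F, U ω v < m (Y ω)} := by
    filter_upwards [hreg] with ω hω
    refine propext ?_
    have h1 := (hω.isLocalForest_iff (u := u) (j := j) (F := F) (B := B) (S := S) rfl
      (c := Y ω) rfl (m := m) rfl).1
    rw [hω.futureMax_eq] at h1
    exact and_comm.trans h1
  have hset' : ((fun ω => selectedThreshold u.length (X ω, U ω)) ⁻¹' B ∩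
      {ω | IsLocalForest (X ω) (U ω) u j F} ∩ (fun ω (v : F) => U ω v) ⁻¹' D : Set Ω) =ᵐ[P]
      ({ω | Y ω ∈ A ∧ ∀ v : F, U ω v < m (Y ω)} ∩ (fun ω (v : F) => U ω v) ⁻¹' D : Set Ω) :=
    hset.inter (ae_eq_refl _)
  have hE : MeasurableSet {ω | Y ω ∈ A ∧ ∀ v : F, U ω v < m (Y ω)} :=
    (hY hA).inter (measurableSet_setOfPred.2 (Measurable.forall fun v =>
      measurableSet_setOfPred.1 (measurableSet_lt (h.measurable_weight v) (hm.comp hY))))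
  rw [Measure.restrict_apply' hL, Measure.restrict_restrict (hW hB), Set.inter_right_comm,
    measure_congr hset', key, setLIntegral_congr hset]
  refine setLIntegral_congr_fun_ae hE ?_
  filter_upwards [hreg] with ω hω hωE
  have h1 := hω.isLocalForest_iff (u := u) (j := j) (F := F) (B := B) (S := S) rfl
      (c := Y ω) rfl (m := m) rfl
  rw [h1.2 (h1.1.2 hωE).1, hω.futureMax_eq]

theorem measure_restrict_forestEvent (k : ℕ) (F : Finset (List ℕ)) {B : Set ℝ}
    (hB : MeasurableSet B) {D : Set (F → ℝ)} (hD : MeasurableSet D) :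
    P.restrict (forestEvent X U k F)
      ((fun ω => selectedThreshold k (X ω, U ω)) ⁻¹' B ∩ (fun ω (v : F) => U ω v) ⁻¹' D) =
    ∫⁻ ω in (fun ω => selectedThreshold k (X ω, U ω)) ⁻¹' B,
      unifKernel F (selectedThreshold k (X ω, U ω)) D ∂P.restrict (forestEvent X U k F) := by
  rw [h.restrict_forestEvent hreg]
  exact sum_measure_apply_eq_setLIntegral fun q => h.measure_restrict_localEvent hreg k F q hB hD

theorem condDistrib_weights (k : ℕ) (F : Finset (List ℕ)) :
    ∀ᵐ a ∂((P[|{ω | forest (X ω) (U ω) k = F}]).map fun ω => futureMax (X ω) (U ω) k),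
      condDistrib (fun ω (v : F) => U ω v) (fun ω => futureMax (X ω) (U ω) k)
        (P[|{ω | forest (X ω) (U ω) k = F}]) a = Measure.pi fun _ : F => unif a := by
  have hac : (P[|{ω | forest (X ω) (U ω) k = F}]) ≪ P := cond_absolutelyContinuous
  have hmax : (fun ω => futureMax (X ω) (U ω) k) =ᵐ[P[|{ω | forest (X ω) (U ω) k = F}]]
      fun ω => selectedThreshold k (X ω, U ω) :=
    hac.ae_le (hreg.mono fun _ hω => hω.futureMax_eq k)
  have hW := h.measurable_selectedThreshold_config k
  have hcomp : (P[|{ω | forest (X ω) (U ω) k = F}]).map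
      (fun ω => (selectedThreshold k (X ω, U ω), fun v : F => U ω v)) =
      (P[|{ω | forest (X ω) (U ω) k = F}]).map (fun ω => selectedThreshold k (X ω, U ω)) ⊗ₘ
        unifKernel F := by
    -- Conditioning on the forest only rescales the restricted measure, and the scalar factors out
    -- on both sides.
    rw [ProbabilityTheory.cond, Measure.restrict_congr_set (forestEvent_ae_eq hreg k F),
      Measure.map_smul, Measure.map_smul, Measure.compProd_smul_left,
      map_prodMk_eq_compProd hW (h.measurable_weights F).aemeasurable fun B D hB hD =>
        h.measure_restrict_forestEvent hreg k F hB hD]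
  have hcond := condDistrib_ae_eq_of_measure_eq_compProd _
    (h.measurable_weights F).aemeasurable hcomp
  rw [condDistrib_congr_right hmax, Measure.map_congr hmax]
  have hpos : ∀ᵐ a ∂((P[|{ω | forest (X ω) (U ω) k = F}]).map
      fun ω => selectedThreshold k (X ω, U ω)), 0 < a := by
    rw [ae_map_iff hW.aemeasurable measurableSet_Ioi]
    exact hac.ae_le (hreg.mono fun ω hω => hω.futureMax_eq k ▸ hω.futureMax_pos k)
  filter_upwards [hcond, hpos] with a ha ha0
  rw [ha, unifKernel_apply ha0]

theorem condDistrib_attachedWeight (k : ℕ) :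
    ∀ᵐ a ∂(P.map fun ω => futureMax (X ω) (U ω) k),
      condDistrib (fun ω => attachedWeight (X ω) (U ω) k) (fun ω => futureMax (X ω) (U ω) k) P a =
        (condDistrib (fun ω => forestSize (X ω) (U ω) k) (fun ω => futureMax (X ω) (U ω) k) P
          a).bind (unifSum a) := by
  have hmax : (fun ω => futureMax (X ω) (U ω) k) =ᵐ[P] fun ω => selectedThreshold k (X ω, U ω) :=
    hreg.mono fun _ hω => hω.futureMax_eq k
  have hW := h.measurable_selectedThreshold_config k
  have hH := h.aemeasurable_forestSize hreg k
  have hB := h.aemeasurable_attachedWeight hreg k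
  rw [condDistrib_congr_right hmax, condDistrib_congr_right hmax, Measure.map_congr hmax]
  set c := condDistrib (fun ω => forestSize (X ω) (U ω) k)
    (fun ω => selectedThreshold k (X ω, U ω)) P with hc
  -- On each forest event the size is constant and the attached weight is the sum of the weights on
  -- `F`, whose law depends on `F` only through its cardinality; the pieces are then added up.
  have hrect : ∀ B D, MeasurableSet B → MeasurableSet D →
      P ((fun ω => selectedThreshold k (X ω, U ω)) ⁻¹' B ∩
        (fun ω => attachedWeight (X ω) (U ω) k) ⁻¹' D) =
      ∫⁻ ω in (fun ω => selectedThreshold k (X ω, U ω)) ⁻¹' B,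
        unifSumKernel (selectedThreshold k (X ω, U ω), forestSize (X ω) (U ω) k) D ∂P := by
    intro B D hB hD
    have hsum := sum_measure_apply_eq_setLIntegral
      (μ := fun F => P.restrict (forestEvent X U k F))
      (s := (fun ω => selectedThreshold k (X ω, U ω)) ⁻¹' B ∩
        (fun ω => attachedWeight (X ω) (U ω) k) ⁻¹' D)
      (t := (fun ω => selectedThreshold k (X ω, U ω)) ⁻¹' B)
      (f := fun ω => unifSumKernel (selectedThreshold k (X ω, U ω), forestSize (X ω) (U ω) k) D)
      fun F => by
        have hae := h.ae_restrict_forestEvent hreg k F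
        have hmeas : Measurable fun z : F → ℝ => ∑ v, z v := by fun_prop
        have h1 := h.measure_restrict_forestEvent hreg k F hB (hmeas hD)
        have h2 : ((fun ω => selectedThreshold k (X ω, U ω)) ⁻¹' B ∩
            (fun ω => attachedWeight (X ω) (U ω) k) ⁻¹' D : Set Ω)
            =ᵐ[P.restrict (forestEvent X U k F)]
            ((fun ω => selectedThreshold k (X ω, U ω)) ⁻¹' B ∩
              (fun ω (v : F) => U ω v) ⁻¹' ((fun z : F → ℝ => ∑ v, z v) ⁻¹' D) : Set Ω) := by
          refine (ae_eq_refl _).inter ?_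
          filter_upwards [hae] with ω hω
          exact congrArg (· ∈ D) hω.2.2
        rw [measure_congr h2, h1]
        refine setLIntegral_congr_fun_ae (hW hB) ?_
        filter_upwards [hae] with ω hω _
        rw [hω.2.1, ← Measure.map_apply hmeas hD, map_sum_unifKernel hω.1, Fintype.card_coe]
    rwa [h.sum_restrict_forestEvent hreg k] at hsum
  -- The forest size is integrated out against its conditional law `c` given the future maximum.
  have hcomp : P.map (fun ω => (selectedThreshold k (X ω, U ω), attachedWeight (X ω) (U ω) k)) =
      P.map (fun ω => selectedThreshold k (X ω, U ω)) ⊗ₘ (c ⊗ₖ unifSumKernel).snd := by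
    refine map_prodMk_eq_compProd hW hB fun B D hB hD => ?_
    rw [hrect B D hB hD]
    exact setLIntegral_eq_setLIntegral_compProd_snd hW hH (compProd_map_condDistrib hH).symm hB hD
  have hcond := condDistrib_ae_eq_of_measure_eq_compProd _ hB hcomp
  have hpos : ∀ᵐ a ∂(P.map fun ω => selectedThreshold k (X ω, U ω)), 0 < a := by
    rw [ae_map_iff hW.aemeasurable measurableSet_Ioi]
    exact hreg.mono fun ω hω => hω.futureMax_eq k ▸ hω.futureMax_pos k
  filter_upwards [hcond, hpos] with a ha ha0
  rw [ha]
  ext D hD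
  rw [Kernel.snd_apply' _ _ hD, Kernel.compProd_apply (measurable_snd hD),
    Measure.bind_apply hD (measurable_of_countable _).aemeasurable]
  refine lintegral_congr fun n => ?_
  rw [unifSumKernel_eq_unifSum ha0]
  rfl

end IsWeightedBPTree

end InvasionPercolation

open InvasionPercolation

theorem lemma1p2 {Ω : Type*} [MeasurableSpace Ω] (P : Measure Ω) [IsProbabilityMeasure P]
    (ν : Measure ℕ) [IsProbabilityMeasure ν] (α c : ℝ) (hν : IsPowerLawOffspring ν α c)
    (X : Ω → List ℕ → ℕ) (U : Ω → List ℕ → ℝ) (hXU : IsWeightedBPTree P ν X U) (k : ℕ) :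
    -- the objects are almost surely well defined, and they are random variables
    (∀ᵐ ω ∂P, (∃! b, IsBackbone (X ω) (U ω) b) ∧ (forest (X ω) (U ω) k).Finite) ∧
    AEMeasurable (fun ω => futureMax (X ω) (U ω) k) P ∧
    AEMeasurable (fun ω => forestSize (X ω) (U ω) k) P ∧
    AEMeasurable (fun ω => attachedWeight (X ω) (U ω) k) P ∧
    (∀ F : Finset (List ℕ), NullMeasurableSet {ω | forest (X ω) (U ω) k = F} P) ∧
    -- given the forest, and given that the future maximum weight is `a`, the weights of the edges
    -- of the forest are i.i.d. uniform on `[0, a]`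
    (∀ F : Finset (List ℕ),
      ∀ᵐ a ∂((P[|{ω | forest (X ω) (U ω) k = F}]).map fun ω => futureMax (X ω) (U ω) k),
        condDistrib (fun ω (v : F) => U ω v) (fun ω => futureMax (X ω) (U ω) k)
            (P[|{ω | forest (X ω) (U ω) k = F}]) a =
          Measure.pi fun _ : F => unif a) ∧
    -- given that the future maximum weight is `a`, the attached weight has the law of the sum of
    -- `forestSize` uniform variables on `[0, a]`, independent of each other and of `forestSize`
    (∀ᵐ a ∂(P.map fun ω => futureMax (X ω) (U ω) k),
      condDistrib (fun ω => attachedWeight (X ω) (U ω) k) (fun ω => futureMax (X ω) (U ω) k) P a =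
        (condDistrib (fun ω => forestSize (X ω) (U ω) k) (fun ω => futureMax (X ω) (U ω) k) P
          a).bind (unifSum a)) := by
  have hreg := hXU.ae_isRegular hν.zero_null hν.measure_two_le_ne_zero
  exact ⟨hreg.mono fun ω hω => ⟨hω.existsUnique_isBackbone, hω.finite_forest k⟩,
    hXU.aemeasurable_futureMax hreg k, hXU.aemeasurable_forestSize hreg k,
    hXU.aemeasurable_attachedWeight hreg k, hXU.nullMeasurableSet_forest hreg k,
    hXU.condDistrib_weights hreg k, hXU.condDistrib_attachedWeight hreg k⟩
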